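/- **Problem.** Let $G=(V,E)$ be a finite directed graph, $n=|V|$, $m=|E|$ (loops and parallel arcs are allowed; an arc $e$ from $i$ to $j$ is written $ij$), and let $d_i$ be the total number of incoming and outgoing arcs at $i$. Each arc has capacities $\ell_{ij}\le u_{ij}$ in $\mathbb R$ and a monotone increasing concave gain function $\Gamma_{ij}:[\ell_{ij},u_{ij}]\to\mathbb R\cup\{-\infty\}$ with $\Gamma_{ij}(u_{ij})>-\infty$ that takes every value in $[\Gamma_{ij}(\ell_{ij}),\Gamma_{ij}(u_{ij})]$ (so it is continuous). Each node has a demand $b_i\in\mathbb R$ and a penalty factor $M_i>0$. A pseudoflow is $f:E\to\mathbb R$ with $\ell\le f\le u$; its excesses are $e_i=\sum_{ji\in E}\Gamma_{ji}(f_{ji})-\sum_{ij\in E}f_{ij}-b_i$. The symmetric concave generalized flow problem is to minimize $\sum_i M_i\kappa_i$ over pseudoflows $f$ and $\kappa\in\mathbb R^V_{\ge0}$ with $e_i+\kappa_i\ge0$ for all $i$. The excess discrepancy of a pseudoflow $f$ is $\kappa_f=\sum_iM_i\max\{-e_i,0\}$, and $f$ is called $\varepsilon$-optimal if $\kappa_f$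 exceeds the optimum value by at most $\varepsilon$. **Normalization.** Replace $\Gamma_{ij}(x)$ by $\Gamma_{ij}(x+\ell_{ij})-\Gamma_{ij}(\ell_{ij})$ if $\Gamma_{ij}(\ell_{ij})>-\infty$ and by $\Gamma_{ij}(x+\ell_{ij})$ otherwise; replace $[\ell_{ij},u_{ij}]$ by $[0,\tilde u_{ij}]$, where $\tilde u_{ij}$ is the smallest point of $[0,u_{ij}-\ell_{ij}]$ at which the new gain function takes its maximum; increase $b_i$ by $\sum_{ij\in E}\ell_{ij}$ and decrease it by the sum of the finite $\Gamma_{ji}(\ell_{ji})$, $ji\in E$. Below, $u,\Gamma,b$ denote the normalized data, $M=\max_iM_i$, and $U$ is the maximum of all $|b_i|$, $u_{ij}$, $|\Gamma_{ij}(u_{ij})|$ and finite $|\Gamma_{ij}(0)|$. **Algorithm (Symmetric Concave Fat-Path), on the normalized instance.** Given a pseudoflow $f$, labels $\mu:V\to\mathbb R_{>0}$ and $\Delta>0$: each arc $ij\in E$ gives a forward residual arc $ij$ if $f_{ij}<u_{ij}$ and a backward residual arc $ji$ if $f_{ij}>0$. The forward arc is $\Delta$-fat if $\Gamma_{ij}(u_{ij})-\Gamma_{ij}(f_{ij})\ge\Delta\mu_j$,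 the backward arc if $f_{ij}\ge\Delta\mu_i$, and then $$\theta_\Delta(ij)=\frac{\Delta\mu_i}{\Gamma_{ij}^{-1}(\Gamma_{ij}(f_{ij})+\Delta\mu_j)-f_{ij}},\qquad \theta_\Delta(ji)=\frac{\Delta\mu_j}{\Gamma_{ij}(f_{ij})-\Gamma_{ij}(f_{ij}-\Delta\mu_i)}.$$ A $\Delta$-fat arc with $\theta_\Delta=1$ is tight. Let $N_0=\{i:e_i\le d_i\Delta\mu_i\}$ and $D=\{i:e_i>(d_i+1)\Delta\mu_i\}$. * *Tighten-Label*: let $S$ be the set of nodes with a (possibly empty) tight path to $N_0$. While $S\ne V$, multiply $\mu_i$ for all $i\in V\setminus S$ by the minimum of the numbers $1/\theta_\Delta(a)$, over $\Delta$-fat arcs $a$ from $V\setminus S$ to $S$, and $e_i/(d_i\Delta\mu_i)$, $i\in V\setminus S$. * *$\Delta$-phase*: repeat: call Tighten-Label; if $D\neq\emptyset$, choose any $s\in D$, $t\in N_0$ and a tight $s$–$t$ path $P$ repeating no node, and send $\Delta\mu_s$ units from $s$ along $P$ (the amount leaving an arc enters the next arc). The iterations of the phase stop when $D=\emptyset$.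 * *Adjust($\Delta$)*, called after the iterations have stopped: for each $\Delta/2$-fat forward arc $ij$ with $\theta_{\Delta/2}(ij)>1$ replace $f_{ij}$ by $\Gamma_{ij}^{-1}(\Gamma_{ij}(f_{ij})+\frac\Delta2\mu_j)$; for each $\Delta/2$-fat backward arc $ji$ with $\theta_{\Delta/2}(ji)>1$ replace $f_{ij}$ by $f_{ij}-\frac\Delta2\mu_i$; leave $f_{ij}$ unchanged otherwise. Then $\Delta$ is replaced by $\Delta/2$ and the next phase begins. Initially $f=u$, $\mu_i=1/M_i$ and $\Delta=MU+1$; the phases may be continued forever. **Theorem.** In every run of the algorithm, for every scaling phase that is reached and whose iterations stop, the pseudoflow $f$ at the end of the $\Delta$-phase is $(2n+3m)\Delta$-optimal, i.e. its excess discrepancy exceeds the optimum by at most $(2n+3m)\Delta$. This holds for $f$ when the iterations of the phase have stopped as well as after the call of Adjust($\Delta$), and both for $f$ in the normalized instance and for $f+\ell$ in the original instance. -/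

import Mathlib

/-- Data of a concave generalized flow problem in the symmetric formulation, on a directed graph
with node set `V` and arc set `E` (parallel arcs and loops are allowed).  Gain functions take
values in `ℝ ∪ {-∞}`; only their values on `[lower e, upper e]` matter. -/
structure GainNetwork (V E : Type*) where
  src : E → V
  tgt : E → V
  lower : E → ℝ
  upper : E → ℝ
  gain : E → ℝ → EReal
  demand : V → ℝ
  penalty : V → ℝ

/-- Arcs of the residual graph: `fwd e` runs from `src e` to `tgt e`, `bwd e` in the opposite
direction. -/
inductive ResArc (E : Type*) where
  | fwd : E → ResArc E
  | bwd : E → ResArc E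

/-- The flow `f` and the labels `μ` maintained by the algorithm. -/
structure FatPathState (V E : Type*) where
  flow : E → ℝ
  label : V → ℝ

namespace GainNetwork

variable {V E : Type*}

/-! ### The problem -/

/-- The standing assumptions on an instance.  `gain_surjOn` says that the inverse value oracle has
an answer to every query in `[Γ(ℓ), Γ(u)]` (equivalently, the gain functions are continuous). -/
structure IsConcave (N : GainNetwork V E) : Prop where
  lower_le_upper : ∀ e, N.lower e ≤ N.upper e
  gain_ne_top : ∀ e, ∀ x ∈ Set.Icc (N.lower e) (N.upper e), N.gain e x ≠ ⊤
  gain_upper_ne_bot : ∀ e, N.gain e (N.upper e) ≠ ⊥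
  gain_mono : ∀ e, MonotoneOn (N.gain e) (Set.Icc (N.lower e) (N.upper e))
  gain_concave : ∀ e, ∀ x ∈ Set.Icc (N.lower e) (N.upper e),
    ∀ y ∈ Set.Icc (N.lower e) (N.upper e), ∀ a b : ℝ, 0 ≤ a → 0 ≤ b → a + b = 1 →
      (a : EReal) * N.gain e x + (b : EReal) * N.gain e y ≤ N.gain e (a * x + b * y)
  gain_surjOn : ∀ e, Set.SurjOn (N.gain e) (Set.Icc (N.lower e) (N.upper e))
    (Set.Icc (N.gain e (N.lower e)) (N.gain e (N.upper e)))
  penalty_pos : ∀ i, 0 < N.penalty i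

def IsPseudoflow (N : GainNetwork V E) (f : E → ℝ) : Prop :=
  ∀ e, N.lower e ≤ f e ∧ f e ≤ N.upper e

open scoped Classical in
/-- The excess `e_i = ∑_{ji} Γ_{ji}(f_{ji}) - ∑_{ij} f_{ij} - b_i`. -/
noncomputable def excess [Fintype E] (N : GainNetwork V E) (f : E → ℝ) (i : V) : EReal :=
  (∑ e with N.tgt e = i, N.gain e (f e)) - ((∑ e with N.src e = i, f e : ℝ) : EReal)
    - (N.demand i : EReal)

/-- `(f, κ)` is a feasible solution of the symmetric formulation. -/
def Feasible [Fintype E] (N : GainNetwork V E) (f : E → ℝ) (κ : V → ℝ) : Prop :=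
  N.IsPseudoflow f ∧ (∀ i, 0 ≤ κ i) ∧ ∀ i, 0 ≤ N.excess f i + (κ i : EReal)

/-- The minimum of `∑ M_i κ_i` over the feasible solutions. -/
noncomputable def optimum [Fintype V] [Fintype E] (N : GainNetwork V E) : EReal :=
  sInf {c : EReal | ∃ (f : E → ℝ) (κ : V → ℝ),
    N.Feasible f κ ∧ c = ((∑ i, N.penalty i * κ i : ℝ) : EReal)}

/-- The excess discrepancy `κ_f = ∑ M_i max{-e_i, 0}` of a pseudoflow. -/
noncomputable def discrepancy [Fintype V] [Fintype E] (N : GainNetwork V E) (f : E → ℝ) : EReal :=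
  ∑ i, (N.penalty i : EReal) * max (-(N.excess f i)) 0

/-- `f` is a pseudoflow whose excess discrepancy exceeds the optimum by at most `ε`. -/
def IsApproxOptimal [Fintype V] [Fintype E] (N : GainNetwork V E) (ε : ℝ) (f : E → ℝ) : Prop :=
  N.IsPseudoflow f ∧ N.discrepancy f ≤ N.optimum + (ε : EReal)

/-! ### Parameters and normalization -/

open scoped Classical in
/-- `d_i`, the total number of incoming and outgoing arcs at `i`. -/
noncomputable def degree [Fintype E] (N : GainNetwork V E) (i : V) : ℕ :=
  (Finset.univ.filter fun e => N.tgt e = i).card + (Finset.univ.filter fun e => N.src e = i).card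

/-- `M`, the largest penalty factor. -/
noncomputable def maxPenalty (N : GainNetwork V E) : ℝ := ⨆ i, N.penalty i

/-- `U`, the maximum of `|b_i|`, `|ℓ_e|`, `|u_e|`, `|Γ_e(u_e)|` and of the finite `|Γ_e(ℓ_e)|`
(`EReal.toReal` sends `-∞` to `0`). -/
noncomputable def maxSize (N : GainNetwork V E) : ℝ :=
  max (⨆ i, |N.demand i|)
    (⨆ e, max (max |N.lower e| |N.upper e|)
      (max |(N.gain e (N.upper e)).toReal| |(N.gain e (N.lower e)).toReal|))

open scoped Classical in
/-- The gain function of the shifted instance: `Γ(x + ℓ) - Γ(ℓ)` if `Γ(ℓ)` is finite, and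
`Γ(x + ℓ)` if `Γ(ℓ) = -∞`. -/
noncomputable def shiftedGain (N : GainNetwork V E) (e : E) (x : ℝ) : EReal :=
  if N.gain e (N.lower e) = ⊥ then N.gain e (x + N.lower e)
  else N.gain e (x + N.lower e) - N.gain e (N.lower e)

open scoped Classical in
/-- The equivalent instance the algorithm works on: lower capacities are shifted to `0`, finite
values `Γ(ℓ)` are shifted to `0` (a term `(Γ(ℓ)).toReal` with `Γ(ℓ) = -∞` is `0`), and the upper
capacity is lowered to the smallest point at which the gain function attains its maximum. -/
noncomputable def normalize [Fintype E] (N : GainNetwork V E) : GainNetwork V E where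
  src := N.src
  tgt := N.tgt
  lower := fun _ => 0
  upper := fun e => sInf {p : ℝ | 0 ≤ p ∧ p ≤ N.upper e - N.lower e ∧
    N.shiftedGain e p = N.shiftedGain e (N.upper e - N.lower e)}
  gain := N.shiftedGain
  demand := fun i => N.demand i + (∑ e with N.src e = i, N.lower e)
    - ∑ e with N.tgt e = i, (N.gain e (N.lower e)).toReal
  penalty := N.penalty

/-- The inverse `Γ_e⁻¹` on `[ℓ_e, u_e]`. -/
noncomputable def gainInv (N : GainNetwork V E) (e : E) (y : EReal) : ℝ :=
  Function.invFunOn (N.gain e) (Set.Icc (N.lower e) (N.upper e)) y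

/-! ### Fat arcs, tight arcs, and the three kinds of nodes

From here on the network is meant to be normalized. -/

def tail (N : GainNetwork V E) : ResArc E → V
  | .fwd e => N.src e
  | .bwd e => N.tgt e

def head (N : GainNetwork V E) : ResArc E → V
  | .fwd e => N.tgt e
  | .bwd e => N.src e

/-- Residual arcs of relabeled fatness at least `Δ`: the fatness is `Γ_e(u_e) - Γ_e(f_e)` on
`fwd e` and `f_e` on `bwd e`, and it is divided by the label of the head. -/
def IsFat (N : GainNetwork V E) (f : E → ℝ) (μ : V → ℝ) (Δ : ℝ) : ResArc E → Prop
  | .fwd e => f e < N.upper e ∧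
      N.gain e (f e) + ((Δ * μ (N.tgt e) : ℝ) : EReal) ≤ N.gain e (N.upper e)
  | .bwd e => 0 < f e ∧ Δ * μ (N.src e) ≤ f e

/-- The linearization `θ` of the relabeled gain in chunks of `Δ`, on fat arcs.  For `bwd e` it is
`Δ μ_j / (Γ_e(f_e) - Γ_e(f_e - Δ μ_i))` with `e = ij`, which is `0` if `Γ_e(f_e - Δ μ_i) = -∞`. -/
noncomputable def theta (N : GainNetwork V E) (f : E → ℝ) (μ : V → ℝ) (Δ : ℝ) : ResArc E → EReal
  | .fwd e => ((Δ * μ (N.src e) /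
      (N.gainInv e (N.gain e (f e) + ((Δ * μ (N.tgt e) : ℝ) : EReal)) - f e) : ℝ) : EReal)
  | .bwd e => ((Δ * μ (N.tgt e) : ℝ) : EReal) /
      (N.gain e (f e) - N.gain e (f e - Δ * μ (N.src e)))

def IsTight (N : GainNetwork V E) (f : E → ℝ) (μ : V → ℝ) (Δ : ℝ) (a : ResArc E) : Prop :=
  N.IsFat f μ Δ a ∧ N.theta f μ Δ a = 1

/-- `N₀`, the `Δ`-negative and `Δ`-neutral nodes: `e_i / μ_i ≤ d_i Δ`. -/
def lowNodes [Fintype E] (N : GainNetwork V E) (f : E → ℝ) (μ : V → ℝ) (Δ : ℝ) : Set V :=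
  {i | N.excess f i ≤ ((N.degree i * Δ * μ i : ℝ) : EReal)}

/-- `D`, the nodes with `e_i / μ_i > (d_i + 1) Δ`. -/
def highNodes [Fintype E] (N : GainNetwork V E) (f : E → ℝ) (μ : V → ℝ) (Δ : ℝ) : Set V :=
  {i | (((N.degree i + 1) * Δ * μ i : ℝ) : EReal) < N.excess f i}

/-! ### Tighten-Label -/

/-- The set `S` of nodes with a (possibly empty) tight path to a `Δ`-negative or `Δ`-neutral
node. -/
def settled [Fintype E] (N : GainNetwork V E) (f : E → ℝ) (μ : V → ℝ) (Δ : ℝ) : Set V :=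
  {i | ∃ t ∈ N.lowNodes f μ Δ, Relation.ReflTransGen
    (fun j k => ∃ a, N.IsTight f μ Δ a ∧ N.tail a = j ∧ N.head a = k) i t}

/-- The numbers whose minimum is the multiplier `α`: `1 / θ(a)` for the fat arcs `a` from outside
`S` into `S`, and `e_i / (μ_i d_i Δ)` for the nodes `i` outside `S` (both written without
division). -/
def multipliers [Fintype E] (N : GainNetwork V E) (f : E → ℝ) (μ : V → ℝ) (Δ : ℝ) : Set ℝ :=
  {r | ∃ a, N.IsFat f μ Δ a ∧ N.tail a ∉ N.settled f μ Δ ∧ N.head a ∈ N.settled f μ Δ ∧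
      (r : EReal) * N.theta f μ Δ a = 1} ∪
  {r | ∃ i ∉ N.settled f μ Δ, N.excess f i = ((r * (N.degree i * Δ * μ i) : ℝ) : EReal)}

open scoped Classical in
/-- One step of Tighten-Label: if `S ≠ V`, multiply the labels outside `S` by `α`. -/
def TightenStep [Fintype E] (N : GainNetwork V E) (f : E → ℝ) (Δ : ℝ) (μ μ' : V → ℝ) : Prop :=
  N.settled f μ Δ ≠ Set.univ ∧ ∃ α, IsLeast (N.multipliers f μ Δ) α ∧
    μ' = fun i => if i ∈ N.settled f μ Δ then μ i else α * μ i

/-- Tighten-Label turns `μ` into `μ'`: iterate the step until `S = V`. -/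
def TightenLabel [Fintype E] (N : GainNetwork V E) (f : E → ℝ) (Δ : ℝ) (μ μ' : V → ℝ) : Prop :=
  Relation.ReflTransGen (N.TightenStep f Δ) μ μ' ∧ N.settled f μ' Δ = Set.univ

/-! ### Sending flow along a path -/

/-- `P` is a walk from `s` to `t` (as a list of consecutive residual arcs). -/
def IsWalk (N : GainNetwork V E) : V → List (ResArc E) → V → Prop
  | s, [], t => s = t
  | s, a :: P, t => N.tail a = s ∧ IsWalk N (N.head a) P t

/-- `P` is a path from `s` to `t`: a walk that repeats no node. -/
def IsPath (N : GainNetwork V E) (s : V) (P : List (ResArc E)) (t : V) : Prop :=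
  N.IsWalk s P t ∧ (s :: P.map N.head).Nodup

open scoped Classical in
/-- Send `β` units along a list of residual arcs: `β` units enter the first arc, and what leaves an
arc enters the next one.  Sending `β` units along `bwd e` lowers `Γ_e(f_e)` by `β`, and the
decrease of `f_e` is what leaves it. -/
noncomputable def send (N : GainNetwork V E) : (E → ℝ) → ℝ → List (ResArc E) → (E → ℝ)
  | f, _, [] => f
  | f, β, .fwd e :: P =>
      send N (Function.update f e (f e + β)) (N.gain e (f e + β) - N.gain e (f e)).toReal P
  | f, β, .bwd e :: P =>
      send N (Function.update f e (N.gainInv e (N.gain e (f e) - (β : EReal))))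
        (f e - N.gainInv e (N.gain e (f e) - (β : EReal))) P

/-! ### The algorithm -/

/-- One iteration within the `Δ`-phase: call Tighten-Label, then send `Δ` units of relabeled flow
along a tight path from a node of `D` to a node of `N₀`. -/
def Iteration [Fintype E] (N : GainNetwork V E) (Δ : ℝ) (x y : FatPathState V E) : Prop :=
  N.TightenLabel x.flow Δ x.label y.label ∧
  ∃ s ∈ N.highNodes x.flow y.label Δ, ∃ t ∈ N.lowNodes x.flow y.label Δ, ∃ P : List (ResArc E),
    N.IsPath s P t ∧ (∀ a ∈ P, N.IsTight x.flow y.label Δ a) ∧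
    y.flow = N.send x.flow (Δ * y.label s) P

/-- The iterations of the `Δ`-phase that is entered in state `x` stop in state `y`: after finitely
many iterations, and possibly a last call of Tighten-Label, the set `D` is empty. -/
def PhaseLoop [Fintype E] (N : GainNetwork V E) (Δ : ℝ) (x y : FatPathState V E) : Prop :=
  ∃ z, Relation.ReflTransGen (N.Iteration Δ) x z ∧
    (y = z ∨ (y.flow = z.flow ∧ N.TightenLabel z.flow Δ z.label y.label)) ∧
    N.highNodes y.flow y.label Δ = ∅

open scoped Classical in
/-- The subroutine Adjust(`Δ`): for every `Δ/2`-fat arc with `θ_{Δ/2} > 1`, increase the amount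
leaving the arc by `Δ/2` times the label of its head. -/
noncomputable def adjust (N : GainNetwork V E) (Δ : ℝ) (f : E → ℝ) (μ : V → ℝ) : E → ℝ :=
  fun e =>
    if N.IsFat f μ (Δ / 2) (.fwd e) ∧ 1 < N.theta f μ (Δ / 2) (.fwd e) then
      N.gainInv e (N.gain e (f e) + ((Δ / 2 * μ (N.tgt e) : ℝ) : EReal))
    else if N.IsFat f μ (Δ / 2) (.bwd e) ∧ 1 < N.theta f μ (Δ / 2) (.bwd e) then
      f e - Δ / 2 * μ (N.src e)
    else f e

/-- `N.PhaseStart Δ x`: some run of the algorithm on `N` enters its `Δ`-phase in state `x`.  It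
starts with `f = u`, `μ_i = 1 / M_i` and `Δ = M U + 1`; after every phase it calls Adjust(`Δ`) and
halves `Δ`. -/
inductive PhaseStart [Fintype E] (N : GainNetwork V E) : ℝ → FatPathState V E → Prop
  | init : PhaseStart N (N.maxPenalty * N.maxSize + 1) ⟨N.upper, fun i => 1 / N.penalty i⟩
  | next {Δ : ℝ} {x y : FatPathState V E} : PhaseStart N Δ x → N.PhaseLoop Δ x y →
      PhaseStart N (Δ / 2) ⟨N.adjust Δ y.flow y.label, y.label⟩

end GainNetwork

/-!
The labels serve as dual variables. Call `(f, μ)` conservative at scale `δ` if no `δ`-fat residual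
arc has `θ_δ > 1`. By concavity, then, for every other pseudoflow `g` and every arc `e = ij`,
`(Γ_e(g_e) - Γ_e(f_e)) / μ_j - (g_e - f_e) / μ_i ≤ δ`
(`IsGainCurve.sub_mul_le_of_isChunkConservative`): the slope beyond the first chunk is at most
`μ_j / μ_i`, and the chunk itself costs at most `δ`. Summing over the arcs, no pseudoflow has a sum
of relabeled excesses `∑ e_i / μ_i` that exceeds the one of `f` by more than `m δ`. If moreover
`μ_i ≥ 1 / M_i` with equality at all nodes with a deficit, this bounds the excess discrepancy of `f`
by that of any feasible solution plus `∑ max(e_i, 0) / μ_i + m δ`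
(`IsPhaseInvariant.isApproxOptimal`).

Conservativity, `μ_i ≥ 1 / M_i`, and `e_i ≥ d_i Δ μ_i` wherever `μ_i > 1 / M_i` are invariants
(`IsPhaseInvariant`). The multiplier of Tighten-Label is at least `1` and is chosen so as to keep
them; sending along a tight path moves exactly one chunk of relabeled flow through every arc and so
changes the excess of its end nodes only (`send_spec`); Adjust moves every arc by at most one half
chunk, which lowers `e_i` by at most `d_i (Δ / 2) μ_i` and restores conservativity at scale `Δ / 2`
(`IsNormalized.adjust_spec`).

When the iterations stop, `D` is empty and `∑ max(e_i, 0) / μ_i ≤ (n + 2m) Δ`; Adjust adds at most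
`m Δ / 2`. So `f` is `(n + 3m) Δ`-optimal both before and after Adjust, which is stronger than
required. Normalization changes no excess, and truncating a pseudoflow of the original instance at
the new capacities lowers none, so the bound carries over (`IsConcave.isApproxOptimal_of_normalize`).
Gains of `-∞` never occur on feasible pseudoflows or during the algorithm, so all computations take
place on the finite parts of the gain functions.
-/

/-! ### Concave gain curves in one variable -/

/-- The finite part of a normalized gain function: a strictly increasing concave function with the
intermediate value property. -/
structure IsGainCurve (s : Set ℝ) (γ : ℝ → ℝ) : Prop where
  concave : ConcaveOn ℝ s γ
  strictMono : StrictMonoOn γ s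
  exists_eq : ∀ x ∈ s, ∀ y ∈ s, ∀ v, γ x ≤ v → v ≤ γ y → ∃ z ∈ s, γ z = v

/-- At the point `x`, producing `b` more units of output costs at least `a` units of input, and
withdrawing `a` units of input costs at least `b` units of output.  With `a = Δ μ_i` and
`b = Δ μ_j` this says that neither residual arc of `ij` is `Δ`-fat with `θ_Δ > 1`. -/
structure IsChunkConservative (s : Set ℝ) (γ : ℝ → ℝ) (x a b : ℝ) : Prop where
  fwd : ∀ y ∈ s, γ y = γ x + b → x + a ≤ y
  bwd : x - a ∈ s → γ (x - a) + b ≤ γ x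

namespace IsGainCurve

variable {s : Set ℝ} {γ : ℝ → ℝ} {x y z a b a' b' : ℝ}

/-- Decreasing slopes, in product form so that the points may coincide. -/
lemma slope_mul_le (h : IsGainCurve s γ) (hx : x ∈ s) (hz : z ∈ s) (hxy : x ≤ y) (hyz : y ≤ z) :
    (γ z - γ y) * (y - x) ≤ (γ y - γ x) * (z - y) := by
  rcases hxy.eq_or_lt with rfl | hxy
  · simp
  rcases hyz.eq_or_lt with rfl | hyz
  · simp
  have := h.concave.slope_anti_adjacent hx hz hxy hyz
  rwa [div_le_div_iff₀ (by linarith) (by linarith)] at this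

lemma mem_of_mem_Icc (h : IsGainCurve s γ) (hx : x ∈ s) (hz : z ∈ s) (hxy : x ≤ y)
    (hyz : y ≤ z) : y ∈ s :=
  h.concave.1.ordConnected.out hx hz ⟨hxy, hyz⟩

lemma lt_iff (h : IsGainCurve s γ) (hx : x ∈ s) (hy : y ∈ s) : γ x < γ y ↔ x < y :=
  h.strictMono.lt_iff_lt hx hy

lemma le_iff (h : IsGainCurve s γ) (hx : x ∈ s) (hy : y ∈ s) : γ x ≤ γ y ↔ x ≤ y :=
  h.strictMono.le_iff_le hx hy

/-- By concavity, a larger output chunk costs at least proportionally more input. -/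
lemma fwd_of_le (h : IsGainCurve s γ) (hx : x ∈ s) (hb : 0 < b)
    (hc : ∀ y ∈ s, γ y = γ x + b → x + a ≤ y) (hbb : b ≤ b') (hab : a' * b ≤ a * b')
    (hy : y ∈ s) (hyx : γ y = γ x + b') : x + a' ≤ y := by
  obtain ⟨w, hw, hwx⟩ := h.exists_eq x hx y hy (γ x + b) (by linarith) (by linarith)
  have hxw : x ≤ w := (h.le_iff hx hw).1 (by linarith)
  have hwy : w ≤ y := (h.le_iff hw hy).1 (by linarith)
  have h1 := h.slope_mul_le hx hy hxw hwy
  have h2 := hc w hw hwx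
  rw [hwx, hyx] at h1
  have h3 : a * b' ≤ (w - x) * b' := mul_le_mul_of_nonneg_right (by linarith) (by linarith)
  have h4 : a' * b ≤ (y - x) * b := by linarith
  have := le_of_mul_le_mul_right h4 hb
  linarith

/-- By concavity, a larger input chunk withdrawn costs at least proportionally more output. -/
lemma bwd_of_le (h : IsGainCurve s γ) (hx : x ∈ s) (ha : 0 < a)
    (hc : x - a ∈ s → γ (x - a) + b ≤ γ x) (haa : a ≤ a') (hab : b' * a ≤ b * a')
    (hy : x - a' ∈ s) : γ (x - a') + b' ≤ γ x := by
  have hw := h.mem_of_mem_Icc hy hx (y := x - a) (by linarith) (by linarith)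
  have h1 := h.slope_mul_le hy hx (y := x - a) (by linarith) (by linarith)
  have h2 := hc hw
  have h3 : b * a' ≤ (γ x - γ (x - a)) * a' :=
    mul_le_mul_of_nonneg_right (by linarith) (by linarith)
  have h4 : b' * a ≤ (γ x - γ (x - a')) * a := by linarith
  have := le_of_mul_le_mul_right h4 ha
  linarith

/-- Sending along a tight forward arc keeps both residual arcs conservative. -/
lemma isChunkConservative_add (h : IsGainCurve s γ) (ha : 0 < a) (hb : 0 < b) (hx : x ∈ s)
    (hxa : x + a ∈ s) (hγ : γ (x + a) = γ x + b) : IsChunkConservative s γ (x + a) a b where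
  fwd y hy hyx := by
    have hxy : x + a ≤ y := (h.le_iff hxa hy).1 (by linarith)
    have h1 := h.slope_mul_le hx hy (y := x + a) (by linarith) hxy
    have h2 : b * a ≤ b * (y - (x + a)) := by rw [hyx, hγ] at h1; linarith
    have := le_of_mul_le_mul_left h2 hb
    linarith
  bwd _ := by simp [hγ]

/-- Sending along a tight backward arc keeps both residual arcs conservative. -/
lemma isChunkConservative_sub (h : IsGainCurve s γ) (ha : 0 < a) (hx : x ∈ s)
    (hγ : γ (x - a) = γ x - b) : IsChunkConservative s γ (x - a) a b where
  fwd y hy hyx := by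
    have : y = x := h.strictMono.injOn hy hx (by linarith)
    linarith
  bwd hy := by
    have h1 := h.slope_mul_le hy hx (y := x - a) (by linarith) (by linarith)
    have h2 : b * a ≤ (γ (x - a) - γ (x - a - a)) * a := by rw [hγ] at h1 ⊢; linarith
    have := le_of_mul_le_mul_right h2 ha
    linarith

/-- If the arc is conservative for chunks of twice the size and one forward chunk has
`θ > 1`, then sending that chunk makes both residual arcs conservative. -/
lemma isChunkConservative_of_fwd (h : IsGainCurve s γ) (hx : x ∈ s)
    (hc : IsChunkConservative s γ x (2 * a) (2 * b)) (hyx : γ y = γ x + b)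
    (hlt : y - x < a) : IsChunkConservative s γ y a b where
  fwd z hz hzy := by
    have := hc.fwd z hz (by linarith)
    linarith
  bwd hw := by
    have := (h.le_iff hw hx).2 (by linarith)
    linarith

/-- If the arc is conservative for chunks of twice the size and one backward chunk has
`θ > 1`, then withdrawing that chunk makes both residual arcs conservative. -/
lemma isChunkConservative_of_bwd (h : IsGainCurve s γ) (hx : x ∈ s)
    (hc : IsChunkConservative s γ x (2 * a) (2 * b)) (hlt : γ x < γ (x - a) + b) :
    IsChunkConservative s γ (x - a) a b where
  fwd z hz hzy := by
    have := (h.lt_iff hx hz).1 (by linarith)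
    linarith
  bwd hw := by
    have e : x - a - a = x - 2 * a := by ring
    rw [e] at hw ⊢
    have := hc.bwd hw
    linarith

/-- A conservative point nearly maximizes `γ(z) / b - z / a` over the whole curve: rounding to
chunks loses at most `1`. -/
lemma sub_mul_le_of_isChunkConservative (h : IsGainCurve s γ) (ha : 0 < a) (hb : 0 < b)
    (hx : x ∈ s) (hc : IsChunkConservative s γ x a b) (hy : y ∈ s) :
    (γ y - γ x) * a ≤ (y - x) * b + a * b := by
  have hab := mul_pos ha hb
  rcases le_or_gt x y with hxy | hxy
  · rcases le_or_gt (γ y - γ x) b with hle | hlt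
    · have h1 := mul_le_mul_of_nonneg_right hle ha.le
      have h2 := mul_nonneg (sub_nonneg.2 hxy) hb.le
      linarith
    · have h1 := h.fwd_of_le hx hb hc.fwd hlt.le (a' := a * (γ y - γ x) / b)
        (by rw [div_mul_cancel₀ _ hb.ne']) hy (by ring)
      have h2 : a * (γ y - γ x) / b ≤ y - x := by linarith
      rw [div_le_iff₀ hb] at h2
      linarith
  · have hγ := (h.lt_iff hy hx).2 hxy
    rcases le_or_gt (x - y) a with hle | hlt
    · have h1 := mul_le_mul_of_nonneg_right hle hb.le
      have h2 := mul_nonneg (sub_nonneg.2 hγ.le) ha.le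
      linarith
    · have h1 := h.bwd_of_le hx ha hc.bwd hlt.le (b' := b * (x - y) / a)
        (by rw [div_mul_cancel₀ _ ha.ne']) (by simpa using hy)
      rw [sub_sub_cancel] at h1
      have h2 : b * (x - y) / a ≤ γ x - γ y := by linarith
      rw [div_le_iff₀ ha] at h2
      linarith

end IsGainCurve

namespace GainNetwork

variable {V E : Type*} {K : GainNetwork V E}

/-! ### Normalized networks and their real-valued data -/

/-- The points of `[ℓ_e, u_e]` at which the gain is not `-∞`. -/
def finiteDom (K : GainNetwork V E) (e : E) : Set ℝ :=
  {x | x ∈ Set.Icc (K.lower e) (K.upper e) ∧ K.gain e x ≠ ⊥}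

/-- The gain as a real number; meaningful on `finiteDom`. -/
noncomputable def realGain (K : GainNetwork V E) (e : E) (x : ℝ) : ℝ := (K.gain e x).toReal

/-- The properties of the normalized instance that the analysis uses. -/
structure IsNormalized (K : GainNetwork V E) : Prop where
  lower_eq : ∀ e, K.lower e = 0
  gain_ne_top : ∀ e, ∀ x ∈ Set.Icc (K.lower e) (K.upper e), K.gain e x ≠ ⊤
  upper_mem : ∀ e, K.upper e ∈ K.finiteDom e
  curve : ∀ e, IsGainCurve (K.finiteDom e) (K.realGain e)
  penalty_pos : ∀ i, 0 < K.penalty i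

namespace IsNormalized

variable {f : E → ℝ} {μ : V → ℝ} {Δ : ℝ} {e : E} {x y v : ℝ}

lemma nonneg_of_mem (hK : K.IsNormalized) (hx : x ∈ K.finiteDom e) : 0 ≤ x := by
  simpa [hK.lower_eq] using hx.1.1

lemma gain_eq (hK : K.IsNormalized) (hx : x ∈ K.finiteDom e) :
    K.gain e x = (K.realGain e x : EReal) :=
  (EReal.coe_toReal (hK.gain_ne_top e x hx.1) hx.2).symm

lemma gainInv_eq (hK : K.IsNormalized) (hy : y ∈ K.finiteDom e) (hv : K.realGain e y = v) :
    K.gainInv e (v : EReal) = y := by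
  have hex : ∃ a ∈ Set.Icc (K.lower e) (K.upper e), K.gain e a = (v : EReal) :=
    ⟨y, hy.1, by rw [hK.gain_eq hy, hv]⟩
  have h1 := Function.invFunOn_mem hex
  have h2 := Function.invFunOn_eq hex
  have h3 : K.gainInv e (v : EReal) ∈ K.finiteDom e := ⟨h1, by
    show K.gain e (Function.invFunOn _ _ _) ≠ ⊥
    rw [h2]; exact EReal.coe_ne_bot v⟩
  refine (hK.curve e).strictMono.injOn h3 hy ?_
  have h4 : K.gain e (K.gainInv e (v : EReal)) = (v : EReal) := h2
  rw [hv, realGain, h4, EReal.toReal_coe]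

lemma isFat_fwd_iff (hK : K.IsNormalized) (hf : f e ∈ K.finiteDom e)
    (hb : 0 < Δ * μ (K.tgt e)) : K.IsFat f μ Δ (.fwd e) ↔
      ∃ y ∈ K.finiteDom e, K.realGain e y = K.realGain e (f e) + Δ * μ (K.tgt e) := by
  have hu := hK.upper_mem e
  simp only [IsFat, hK.gain_eq hf, hK.gain_eq hu, ← EReal.coe_add, EReal.coe_le_coe_iff]
  constructor
  · rintro ⟨-, h⟩
    exact (hK.curve e).exists_eq _ hf _ hu _ (by linarith) h
  · rintro ⟨y, hy, hyf⟩
    have h1 := ((hK.curve e).lt_iff hf hy).1 (by linarith)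
    have h2 : y ≤ K.upper e := hy.1.2
    exact ⟨h1.trans_le h2, hyf ▸ ((hK.curve e).le_iff hy hu).2 h2⟩

lemma gainInv_fwd (hK : K.IsNormalized) (hf : f e ∈ K.finiteDom e) (hy : y ∈ K.finiteDom e)
    (hyf : K.realGain e y = K.realGain e (f e) + v) :
    K.gainInv e (K.gain e (f e) + (v : EReal)) = y := by
  rw [hK.gain_eq hf, ← EReal.coe_add, hK.gainInv_eq hy hyf]

lemma theta_fwd (hK : K.IsNormalized) (hf : f e ∈ K.finiteDom e) (hy : y ∈ K.finiteDom e)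
    (hyf : K.realGain e y = K.realGain e (f e) + Δ * μ (K.tgt e)) :
    K.theta f μ Δ (.fwd e) = ((Δ * μ (K.src e) / (y - f e) : ℝ) : EReal) := by
  simp only [theta, hK.gainInv_fwd hf hy hyf]

lemma theta_bwd (hK : K.IsNormalized) (hf : f e ∈ K.finiteDom e)
    (hy : f e - Δ * μ (K.src e) ∈ K.finiteDom e) :
    K.theta f μ Δ (.bwd e) = ((Δ * μ (K.tgt e) /
      (K.realGain e (f e) - K.realGain e (f e - Δ * μ (K.src e))) : ℝ) : EReal) := by
  simp only [theta, hK.gain_eq hf, hK.gain_eq hy, ← EReal.coe_sub, ← EReal.coe_div]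

lemma isFat_bwd_of_mem (hK : K.IsNormalized) (ha : 0 < Δ * μ (K.src e))
    (hy : f e - Δ * μ (K.src e) ∈ K.finiteDom e) : K.IsFat f μ Δ (.bwd e) := by
  have := hK.nonneg_of_mem hy
  exact ⟨by linarith, by linarith⟩

/-- If withdrawing a chunk would make the gain `-∞`, then `θ` is `0`. -/
lemma theta_bwd_eq_zero (hK : K.IsNormalized) (hf : f e ∈ K.finiteDom e)
    (ha : 0 < Δ * μ (K.src e)) (hfat : K.IsFat f μ Δ (.bwd e))
    (hy : f e - Δ * μ (K.src e) ∉ K.finiteDom e) : K.theta f μ Δ (.bwd e) = 0 := by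
  have h1 : K.gain e (f e - Δ * μ (K.src e)) = ⊥ := by
    by_contra h
    have h2 : f e ≤ K.upper e := hf.1.2
    have h3 := hfat.2
    exact hy ⟨⟨by rw [hK.lower_eq]; linarith, by linarith⟩, h⟩
  simp only [theta, h1, hK.gain_eq hf, EReal.coe_sub_bot, EReal.div_top]

end IsNormalized

/-! ### Conservative labels -/

/-- No `Δ`-fat residual arc has `θ_Δ > 1`. -/
def IsConservative (K : GainNetwork V E) (f : E → ℝ) (μ : V → ℝ) (Δ : ℝ) : Prop :=
  ∀ e, IsChunkConservative (K.finiteDom e) (K.realGain e) (f e)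
    (Δ * μ (K.src e)) (Δ * μ (K.tgt e))

namespace IsNormalized

variable {f : E → ℝ} {μ : V → ℝ} {Δ : ℝ} {e : E} {x y v : ℝ}

lemma of_isTight_fwd (hK : K.IsNormalized) (hf : f e ∈ K.finiteDom e)
    (hb : 0 < Δ * μ (K.tgt e)) (ht : K.IsTight f μ Δ (.fwd e)) :
    f e + Δ * μ (K.src e) ∈ K.finiteDom e ∧
      K.realGain e (f e + Δ * μ (K.src e)) = K.realGain e (f e) + Δ * μ (K.tgt e) := by
  obtain ⟨y, hy, hyf⟩ := (hK.isFat_fwd_iff hf hb).1 ht.1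
  have h1 := ht.2
  rw [hK.theta_fwd hf hy hyf] at h1
  have h2 := ((hK.curve e).lt_iff hf hy).1 (by linarith)
  have h3 : Δ * μ (K.src e) / (y - f e) = 1 := by exact_mod_cast h1
  rw [div_eq_one_iff_eq (by linarith)] at h3
  rw [h3, add_sub_cancel]
  exact ⟨hy, hyf⟩

lemma of_isTight_bwd (hK : K.IsNormalized) (hf : f e ∈ K.finiteDom e)
    (ha : 0 < Δ * μ (K.src e)) (ht : K.IsTight f μ Δ (.bwd e)) :
    f e - Δ * μ (K.src e) ∈ K.finiteDom e ∧
      K.realGain e (f e - Δ * μ (K.src e)) = K.realGain e (f e) - Δ * μ (K.tgt e) := by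
  have h1 := ht.2
  have hy : f e - Δ * μ (K.src e) ∈ K.finiteDom e := by
    by_contra hy
    rw [hK.theta_bwd_eq_zero hf ha ht.1 hy] at h1
    exact zero_ne_one h1
  have h2 := ((hK.curve e).lt_iff hy hf).2 (by linarith)
  rw [hK.theta_bwd hf hy] at h1
  have h3 : Δ * μ (K.tgt e) /
    (K.realGain e (f e) - K.realGain e (f e - Δ * μ (K.src e))) = 1 := by exact_mod_cast h1
  rw [div_eq_one_iff_eq (by linarith)] at h3
  exact ⟨hy, by linarith⟩

lemma one_lt_theta_fwd_iff (hK : K.IsNormalized) (hf : f e ∈ K.finiteDom e)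
    (hb : 0 < Δ * μ (K.tgt e)) (hy : y ∈ K.finiteDom e)
    (hyf : K.realGain e y = K.realGain e (f e) + Δ * μ (K.tgt e)) :
    1 < K.theta f μ Δ (.fwd e) ↔ y - f e < Δ * μ (K.src e) := by
  have h2 := ((hK.curve e).lt_iff hf hy).1 (by linarith)
  rw [hK.theta_fwd hf hy hyf, ← one_lt_div (sub_pos.2 h2)]
  exact_mod_cast Iff.rfl

lemma one_lt_theta_bwd_iff (hK : K.IsNormalized) (hf : f e ∈ K.finiteDom e)
    (ha : 0 < Δ * μ (K.src e)) (hy : f e - Δ * μ (K.src e) ∈ K.finiteDom e) :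
    1 < K.theta f μ Δ (.bwd e) ↔
      K.realGain e (f e) < K.realGain e (f e - Δ * μ (K.src e)) + Δ * μ (K.tgt e) := by
  have h2 := ((hK.curve e).lt_iff hy hf).2 (by linarith)
  rw [hK.theta_bwd hf hy, ← sub_lt_iff_lt_add', ← one_lt_div (sub_pos.2 h2)]
  exact_mod_cast Iff.rfl

/-- The multiplier of Tighten-Label is at least `1`: on a conservative pseudoflow no fat arc has
`θ > 1`, and nodes outside `S` have excess above `d_i Δ μ_i`. -/
lemma one_le_of_mem_multipliers [Fintype E] (hK : K.IsNormalized)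
    (hf : ∀ e, f e ∈ K.finiteDom e) (hμ : ∀ i, 0 < Δ * μ i) (hc : K.IsConservative f μ Δ)
    {α : ℝ} (hα : α ∈ K.multipliers f μ Δ) : 1 ≤ α := by
  rcases hα with ⟨a, hfat, -, -, ha⟩ | ⟨i, hi, he⟩
  · cases a with
    | fwd e =>
      obtain ⟨y, hy, hyf⟩ := (hK.isFat_fwd_iff (hf e) (hμ _)).1 hfat
      have h1 := (hc e).fwd y hy hyf
      have h2 := hμ (K.src e)
      rw [hK.theta_fwd (hf e) hy hyf] at ha
      have h3 : α * (Δ * μ (K.src e) / (y - f e)) = 1 := by exact_mod_cast ha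
      have h4 : Δ * μ (K.src e) / (y - f e) ≤ 1 := (div_le_one (by linarith)).2 (by linarith)
      have h5 : 0 < Δ * μ (K.src e) / (y - f e) := div_pos h2 (by linarith)
      nlinarith
    | bwd e =>
      by_cases hy : f e - Δ * μ (K.src e) ∈ K.finiteDom e
      · have h1 := (hc e).bwd hy
        have h2 := hμ (K.tgt e)
        rw [hK.theta_bwd (hf e) hy] at ha
        have h3 : α * (Δ * μ (K.tgt e) /
          (K.realGain e (f e) - K.realGain e (f e - Δ * μ (K.src e)))) = 1 := by
            exact_mod_cast ha
        have h4 : Δ * μ (K.tgt e) / (K.realGain e (f e) - K.realGain e (f e - Δ * μ (K.src e)))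
          ≤ 1 := (div_le_one (by linarith)).2 (by linarith)
        have h5 : 0 < Δ * μ (K.tgt e) /
          (K.realGain e (f e) - K.realGain e (f e - Δ * μ (K.src e))) := div_pos h2 (by linarith)
        nlinarith
      · rw [hK.theta_bwd_eq_zero (hf e) (hμ _) hfat hy, mul_zero] at ha
        exact absurd ha zero_ne_one
  · have hlow : i ∉ K.lowNodes f μ Δ := fun h => hi ⟨i, h, .refl⟩
    simp only [lowNodes, Set.mem_ofPred_eq, not_le, he, EReal.coe_lt_coe_iff] at hlow
    have h1 : 0 ≤ K.degree i * Δ * μ i := by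
      rw [mul_assoc]; exact mul_nonneg (Nat.cast_nonneg _) (hμ i).le
    by_contra hlt
    push Not at hlt
    nlinarith

open scoped Classical in
/-- Relabeling preserves conservativity: residual arcs from `V \ S` into `S` stay conservative by
the choice of `α`, and all others by concavity. -/
lemma isConservative_relabel [Fintype E] (hK : K.IsNormalized)
    (hf : ∀ e, f e ∈ K.finiteDom e) (hΔ : 0 < Δ) (hμ : ∀ i, 0 < μ i)
    (hc : K.IsConservative f μ Δ)
    {α : ℝ} (hα : IsLeast (K.multipliers f μ Δ) α) : K.IsConservative f
      (fun i => if i ∈ K.settled f μ Δ then μ i else α * μ i) Δ := by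
  have hp : ∀ i, 0 < Δ * μ i := fun i => mul_pos hΔ (hμ i)
  have h1 := hK.one_le_of_mem_multipliers hf hp hc hα.1
  intro e
  have ha := hp (K.src e)
  have hb := hp (K.tgt e)
  have hle : ∀ i, Δ * μ i ≤ Δ * (α * μ i) := fun i => by
    have := mul_le_mul_of_nonneg_right h1 (hp i).le
    linarith
  have habP := mul_pos ha hb
  have habα := mul_le_mul_of_nonneg_right h1 habP.le
  by_cases hs : K.src e ∈ K.settled f μ Δ <;> by_cases ht : K.tgt e ∈ K.settled f μ Δ <;>
    simp only [hs, ht, if_true, if_false]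
  · exact hc e
  · refine ⟨fun y hy hyf => (hK.curve e).fwd_of_le (hf e) hb (hc e).fwd (hle _) (by linarith) hy hyf,
      fun hy => ?_⟩
    have h2 := ((hK.curve e).lt_iff hy (hf e)).2 (by linarith)
    have h3 : α ≤ (K.realGain e (f e) - K.realGain e (f e - Δ * μ (K.src e))) /
      (Δ * μ (K.tgt e)) := hα.2 (Or.inl ⟨.bwd e, hK.isFat_bwd_of_mem ha hy, ht, hs, by
        rw [hK.theta_bwd (hf e) hy]
        norm_cast
        rw [div_mul_div_cancel₀ hb.ne', div_self (by linarith)]⟩)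
    rw [le_div_iff₀ hb] at h3
    linarith
  · refine ⟨fun y hy hyf => ?_, fun hy => (hK.curve e).bwd_of_le (hf e) ha (hc e).bwd (hle _)
      (by linarith) hy⟩
    have h2 := ((hK.curve e).lt_iff (hf e) hy).1 (by linarith)
    have h3 : α ≤ (y - f e) / (Δ * μ (K.src e)) := hα.2 (Or.inl ⟨.fwd e,
      (hK.isFat_fwd_iff (hf e) hb).2 ⟨y, hy, hyf⟩, hs, ht, by
        rw [hK.theta_fwd (hf e) hy hyf]
        norm_cast
        rw [div_mul_div_cancel₀ ha.ne', div_self (by linarith)]⟩)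
    rw [le_div_iff₀ ha] at h3
    linarith
  · exact ⟨fun y hy hyf => (hK.curve e).fwd_of_le (hf e) hb (hc e).fwd (hle _) (by linarith) hy hyf,
      fun hy => (hK.curve e).bwd_of_le (hf e) ha (hc e).bwd (hle _) (by linarith) hy⟩

end IsNormalized

/-! ### Excesses as real numbers -/

open scoped Classical in
/-- The excess as a real number; meaningful if every gain is finite. -/
noncomputable def realExcess [Fintype E] (K : GainNetwork V E) (f : E → ℝ) (i : V) : ℝ :=
  (∑ e with K.tgt e = i, K.realGain e (f e)) - (∑ e with K.src e = i, f e) - K.demand i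

lemma coe_sum_ereal {ι : Type*} (s : Finset ι) (g : ι → ℝ) :
    ((∑ j ∈ s, g j : ℝ) : EReal) = ∑ j ∈ s, (g j : EReal) :=
  map_sum (⟨⟨Real.toEReal, EReal.coe_zero⟩, EReal.coe_add⟩ : ℝ →+ EReal) g s

lemma sum_eq_bot_of_mem {ι : Type*} {s : Finset ι} {g : ι → EReal} {j : ι} (hj : j ∈ s)
    (h : g j = ⊥) : ∑ j ∈ s, g j = ⊥ := by
  classical
  rw [← Finset.add_sum_erase s g hj, h, EReal.bot_add]

namespace IsNormalized

variable [Fintype E] {f : E → ℝ}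

lemma excess_eq (hK : K.IsNormalized) (hf : ∀ e, f e ∈ K.finiteDom e) (i : V) :
    K.excess f i = (K.realExcess f i : EReal) := by
  simp only [excess, realExcess, EReal.coe_sub, coe_sum_ereal, fun e => hK.gain_eq (hf e)]

end IsNormalized

/-- Only pseudoflows with finite gains are feasible. -/
lemma mem_finiteDom_of_feasible [Fintype E] {g : E → ℝ} (hg : K.IsPseudoflow g) {κ : V → ℝ}
    (h : ∀ i, 0 ≤ K.excess g i + (κ i : EReal)) (e : E) : g e ∈ K.finiteDom e := by
  classical
  refine ⟨hg e, fun hbot => ?_⟩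
  have h1 := h (K.tgt e)
  have h2 : ∑ e' with K.tgt e' = K.tgt e, K.gain e' (g e') = ⊥ :=
    sum_eq_bot_of_mem (j := e) (by simp) hbot
  rw [excess, h2] at h1
  simp [EReal.bot_sub] at h1

open scoped Classical in
lemma realExcess_update [Fintype E] (K : GainNetwork V E) (f : E → ℝ) (e : E) (x : ℝ) (i : V) :
    K.realExcess (Function.update f e x) i = K.realExcess f i
      + (if K.tgt e = i then K.realGain e x - K.realGain e (f e) else 0)
      - (if K.src e = i then x - f e else 0) := by
  have key : ∀ (h : E → ℝ → ℝ) (p : E → Prop),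
      ∑ e' with p e', h e' (Function.update f e x e') =
        (∑ e' with p e', h e' (f e')) + if p e then h e x - h e (f e) else 0 := by
    intro h p
    rw [← sub_eq_iff_eq_add', ← Finset.sum_sub_distrib, Finset.sum_filter,
      Finset.sum_eq_single e]
    · simp
    · intro e' _ hne
      simp [Function.update_of_ne hne]
    · simp
  have h1 := key K.realGain (fun e' => K.tgt e' = i)
  have h2 := key (fun _ z => z) (fun e' => K.src e' = i)
  simp only [realExcess]
  rw [h1, h2]
  ring

/-! ### The invariant of the algorithm -/

/-- What holds throughout a `Δ`-phase.  Labels start at `1 / M_i`, and only nodes with a large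
excess have their labels raised. -/
structure IsPhaseInvariant [Fintype E] (K : GainNetwork V E) (Δ : ℝ) (f : E → ℝ) (μ : V → ℝ) :
    Prop where
  scale_pos : 0 < Δ
  mem : ∀ e, f e ∈ K.finiteDom e
  penalty_le : ∀ i, 1 / K.penalty i ≤ μ i
  conservative : K.IsConservative f μ Δ
  le_excess : ∀ i, 1 / K.penalty i < μ i → K.degree i * Δ * μ i ≤ K.realExcess f i

namespace IsPhaseInvariant

variable [Fintype E] {f : E → ℝ} {μ μ' : V → ℝ} {Δ : ℝ}

lemma label_pos (h : K.IsPhaseInvariant Δ f μ) (hK : K.IsNormalized) (i : V) : 0 < μ i :=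
  (one_div_pos.2 (hK.penalty_pos i)).trans_le (h.penalty_le i)

lemma scale_mul_pos (h : K.IsPhaseInvariant Δ f μ) (hK : K.IsNormalized) (i : V) :
    0 < Δ * μ i :=
  mul_pos h.scale_pos (h.label_pos hK i)

lemma tightenStep (h : K.IsPhaseInvariant Δ f μ) (hK : K.IsNormalized)
    (hs : K.TightenStep f Δ μ μ') : K.IsPhaseInvariant Δ f μ' := by
  classical
  obtain ⟨-, α, hα, rfl⟩ := hs
  have hp := h.scale_mul_pos hK
  have h1 := hK.one_le_of_mem_multipliers h.mem hp h.conservative hα.1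
  refine ⟨h.scale_pos, h.mem, fun i => ?_, ?_, fun i hi => ?_⟩
  · refine (h.penalty_le i).trans ?_
    have := le_mul_of_one_le_left (h.label_pos hK i).le h1
    split_ifs
    exacts [le_rfl, this]
  · convert hK.isConservative_relabel h.mem h.scale_pos (h.label_pos hK) h.conservative hα
  · by_cases his : i ∈ K.settled f μ Δ
    · simp only [his, if_true] at hi ⊢
      exact h.le_excess i hi
    · simp only [his, if_false] at hi ⊢
      have hlow : i ∉ K.lowNodes f μ Δ := fun h => his ⟨i, h, .refl⟩
      simp only [lowNodes, Set.mem_ofPred_eq, not_le, hK.excess_eq h.mem,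
        EReal.coe_lt_coe_iff] at hlow
      -- An isolated node gives no multiplier, but its bound is `0` for every label.
      rcases (Nat.cast_nonneg (K.degree i) : (0 : ℝ) ≤ K.degree i).eq_or_lt with hd | hd
      · simp only [← hd, zero_mul] at hlow ⊢
        exact hlow.le
      · have hpos : 0 < K.degree i * Δ * μ i := by
          rw [mul_assoc]; exact mul_pos hd (hp i)
        have h2 : α ≤ K.realExcess f i / (K.degree i * Δ * μ i) :=
          hα.2 (Or.inr ⟨i, his, by rw [hK.excess_eq h.mem, div_mul_cancel₀ _ hpos.ne']⟩)
        rw [le_div_iff₀ hpos] at h2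
        linarith

lemma tightenLabel (h : K.IsPhaseInvariant Δ f μ) (hK : K.IsNormalized)
    (ht : K.TightenLabel f Δ μ μ') : K.IsPhaseInvariant Δ f μ' := by
  obtain ⟨hr, -⟩ := ht
  induction hr with
  | refl => exact h
  | tail _ hs ih => exact ih.tightenStep hK hs

end IsPhaseInvariant

/-! ### Sending flow along a tight path -/

/-- The arc of the network underlying a residual arc. -/
def _root_.ResArc.arc : ResArc E → E
  | .fwd e => e
  | .bwd e => e

lemma isTight_congr {f g : E → ℝ} {μ : V → ℝ} {Δ : ℝ} {a : ResArc E} (h : f a.arc = g a.arc) :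
    K.IsTight f μ Δ a ↔ K.IsTight g μ Δ a := by
  cases a <;> simp only [ResArc.arc] at h <;> simp only [IsTight, IsFat, theta, h]

/-- Two residual arcs of the same arc end at one of the two ends of the first of them. -/
lemma head_eq_of_arc_eq {a b : ResArc E} (h : b.arc = a.arc) :
    K.head b = K.tail a ∨ K.head b = K.head a := by
  cases a <;> cases b <;> simp_all [ResArc.arc, head, tail]

lemma isConservative_update [DecidableEq E] {f : E → ℝ} {μ : V → ℝ} {Δ x : ℝ} {e : E}
    (hc : K.IsConservative f μ Δ)
    (hx : IsChunkConservative (K.finiteDom e) (K.realGain e) x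
      (Δ * μ (K.src e)) (Δ * μ (K.tgt e))) :
    K.IsConservative (Function.update f e x) μ Δ := by
  intro e'
  rcases eq_or_ne e' e with rfl | hne
  · simpa using hx
  · simpa [Function.update_of_ne hne] using hc e'

open scoped Classical in
/-- Sending `Δ μ_s` units along a tight path moves the same relabeled amount through every arc, so
that only the excesses of the two end nodes change, and all labels stay conservative. -/
lemma send_spec [Fintype E] (hK : K.IsNormalized) {μ : V → ℝ} {Δ : ℝ} (hμ : ∀ i, 0 < Δ * μ i)
    {t : V} (P : List (ResArc E)) (s : V) (f : E → ℝ) (hf : ∀ e, f e ∈ K.finiteDom e)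
    (hc : K.IsConservative f μ Δ) (hP : K.IsPath s P t) (ht : ∀ a ∈ P, K.IsTight f μ Δ a) :
    (∀ e, K.send f (Δ * μ s) P e ∈ K.finiteDom e) ∧
    K.IsConservative (K.send f (Δ * μ s) P) μ Δ ∧
    ∀ i, K.realExcess (K.send f (Δ * μ s) P) i = K.realExcess f i
      - (if s = i then Δ * μ s else 0) + (if t = i then Δ * μ t else 0) := by
  induction P generalizing s f with
  | nil =>
    obtain rfl : s = t := hP.1
    exact ⟨hf, hc, fun i => by simp [send]⟩
  | cons a P ih =>
    obtain ⟨⟨has, hw⟩, hnd⟩ := hP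
    rw [List.map_cons, List.nodup_cons] at hnd
    -- The path repeats no node, so its remaining arcs do not use the arc just updated.
    have htail : ∀ x : ℝ, ∀ b ∈ P, K.IsTight (Function.update f a.arc x) μ Δ b := by
      intro x b hb
      have hne : b.arc ≠ a.arc := fun hba => by
        have hbm := List.mem_map_of_mem (f := K.head) hb
        rcases head_eq_of_arc_eq (K := K) hba with h | h
        · exact hnd.1 (by rw [← has, ← h]; exact List.mem_cons_of_mem _ hbm)
        · exact (List.nodup_cons.1 hnd.2).1 (h ▸ hbm)
      exact (isTight_congr (Function.update_of_ne hne _ _)).2 (ht b (List.mem_cons_of_mem _ hb))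
    have hmem : ∀ x ∈ K.finiteDom a.arc, ∀ e, Function.update f a.arc x e ∈ K.finiteDom e := by
      intro x hx e
      rcases eq_or_ne e a.arc with rfl | hne
      · simpa using hx
      · simpa [Function.update_of_ne hne] using hf e
    have hta := ht a List.mem_cons_self
    cases a with
    | fwd e =>
      simp only [ResArc.arc, head, tail] at *
      subst has
      obtain ⟨hx, hγ⟩ := hK.of_isTight_fwd (hf e) (hμ _) hta
      obtain ⟨h1, h2, h3⟩ := ih (K.tgt e) (Function.update f e (f e + Δ * μ (K.src e)))
        (hmem _ hx) (isConservative_update hc ((hK.curve e).isChunkConservative_add (hμ _)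
          (hμ _) (hf e) hx hγ)) ⟨hw, hnd.2⟩ (htail _)
      have hβ : (K.gain e (f e + Δ * μ (K.src e)) - K.gain e (f e)).toReal = Δ * μ (K.tgt e) := by
        rw [hK.gain_eq hx, hK.gain_eq (hf e), ← EReal.coe_sub, EReal.toReal_coe, hγ,
          add_sub_cancel_left]
      simp only [send, hβ]
      refine ⟨h1, h2, fun i => ?_⟩
      rw [h3, realExcess_update, hγ]
      split_ifs <;> ring
    | bwd e =>
      simp only [ResArc.arc, head, tail] at *
      subst has
      obtain ⟨hx, hγ⟩ := hK.of_isTight_bwd (hf e) (hμ _) hta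
      obtain ⟨h1, h2, h3⟩ := ih (K.src e) (Function.update f e (f e - Δ * μ (K.src e)))
        (hmem _ hx) (isConservative_update hc ((hK.curve e).isChunkConservative_sub (hμ _)
          (hf e) hγ)) ⟨hw, hnd.2⟩ (htail _)
      have hinv : K.gainInv e (K.gain e (f e) - ((Δ * μ (K.tgt e) : ℝ) : EReal))
          = f e - Δ * μ (K.src e) := by
        rw [hK.gain_eq (hf e), ← EReal.coe_sub, hK.gainInv_eq hx hγ]
      simp only [send, hinv, sub_sub_cancel]
      refine ⟨h1, h2, fun i => ?_⟩
      rw [h3, realExcess_update, hγ]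
      split_ifs <;> ring

lemma IsPhaseInvariant.iteration [Fintype E] {Δ : ℝ} {x y : FatPathState V E}
    (h : K.IsPhaseInvariant Δ x.flow x.label) (hK : K.IsNormalized) (hxy : K.Iteration Δ x y) :
    K.IsPhaseInvariant Δ y.flow y.label := by
  classical
  obtain ⟨htl, s, hs, t, -, P, hP, htight, hflow⟩ := hxy
  have h' := h.tightenLabel hK htl
  have hp := h'.scale_mul_pos hK
  obtain ⟨h1, h2, h3⟩ := send_spec hK hp P s x.flow h'.mem h'.conservative hP htight
  rw [← hflow] at h1 h2 h3
  refine ⟨h'.scale_pos, h1, h'.penalty_le, h2, fun i hi => ?_⟩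
  rw [h3]
  have ht0 : 0 ≤ if t = i then Δ * y.label t else 0 := by
    split_ifs
    exacts [(hp t).le, le_rfl]
  rcases eq_or_ne s i with rfl | hne
  · simp only [highNodes, Set.mem_ofPred_eq, hK.excess_eq h'.mem, EReal.coe_lt_coe_iff] at hs
    simp only [if_true]
    linarith
  · have := h'.le_excess i hi
    simp only [hne, if_false]
    linarith

lemma IsPhaseInvariant.phaseLoop [Fintype E] {Δ : ℝ} {x y : FatPathState V E}
    (h : K.IsPhaseInvariant Δ x.flow x.label) (hK : K.IsNormalized) (hxy : K.PhaseLoop Δ x y) :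
    K.IsPhaseInvariant Δ y.flow y.label := by
  obtain ⟨z, hz, hy, -⟩ := hxy
  have hz' : K.IsPhaseInvariant Δ z.flow z.label := by
    clear hy
    induction hz with
    | refl => exact h
    | tail _ hs ih => exact ih.iteration hK hs
  rcases hy with rfl | ⟨hf, ht⟩
  · exact hz'
  · rw [hf]
    exact hz'.tightenLabel hK ht

/-! ### Halving the scaling parameter -/

open scoped Classical in
/-- What Adjust does to one arc, with `a = (Δ/2) μ_i` and `b = (Δ/2) μ_j`: the arc becomes
conservative for the halved chunks, the excess of either end drops by at most one such chunk, and
the excesses rise by at most one such chunk in total. -/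
lemma IsNormalized.adjust_spec (hK : K.IsNormalized) {f : E → ℝ} {μ : V → ℝ} {Δ : ℝ}
    (hf : ∀ e, f e ∈ K.finiteDom e) (hμ : ∀ i, 0 < Δ / 2 * μ i) (hc : K.IsConservative f μ Δ)
    (e : E) {x a b : ℝ} (hx : x = K.adjust Δ f μ e) (ha : a = Δ / 2 * μ (K.src e))
    (hb : b = Δ / 2 * μ (K.tgt e)) :
    x ∈ K.finiteDom e ∧ IsChunkConservative (K.finiteDom e) (K.realGain e) x a b ∧
    K.realGain e (f e) ≤ K.realGain e x + b ∧ x ≤ f e + a ∧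
    max (K.realGain e x - K.realGain e (f e)) 0 * a + max (f e - x) 0 * b ≤ a * b := by
  have ha0 : 0 < a := ha ▸ hμ _
  have hb0 : 0 < b := hb ▸ hμ _
  have hc2 : IsChunkConservative (K.finiteDom e) (K.realGain e) (f e) (2 * a) (2 * b) := by
    have := hc e
    rwa [show Δ * μ (K.src e) = 2 * a by rw [ha]; ring,
      show Δ * μ (K.tgt e) = 2 * b by rw [hb]; ring] at this
  have hF := fun y => hK.one_lt_theta_fwd_iff (Δ := Δ / 2) (μ := μ) (y := y) (hf e) (hμ _)
  have hfF := hK.isFat_fwd_iff (Δ := Δ / 2) (μ := μ) (hf e) (hμ _)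
  have hB := hK.one_lt_theta_bwd_iff (Δ := Δ / 2) (μ := μ) (hf e) (hμ _)
  have hB0 := hK.theta_bwd_eq_zero (Δ := Δ / 2) (μ := μ) (hf e) (hμ _)
  have hfB := hK.isFat_bwd_of_mem (f := f) (e := e) (Δ := Δ / 2) (μ := μ) (hμ _)
  unfold adjust at hx
  rw [← ha] at hF hB hB0 hfB
  rw [← hb] at hF hfF hB
  simp only [← ha, ← hb] at hx
  split_ifs at hx with h1 h2
  · obtain ⟨y, hy, hyf⟩ := hfF.1 h1.1
    have hlt := (hF y hy hyf).1 h1.2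
    obtain rfl : x = y := hx.trans (hK.gainInv_fwd (hf e) hy hyf)
    have hfx := ((hK.curve e).lt_iff (hf e) hy).1 (by linarith)
    refine ⟨hy, (hK.curve e).isChunkConservative_of_fwd (hf e) hc2 hyf hlt, by linarith,
      by linarith, ?_⟩
    rw [hyf, max_eq_right (by linarith : f e - x ≤ 0), add_sub_cancel_left, max_eq_left hb0.le]
    linarith
  · have hm : f e - a ∈ K.finiteDom e := by
      by_contra hm
      have := h2.2
      rw [hB0 h2.1 hm] at this
      exact absurd this (by simp)
    have hlt := (hB hm).1 h2.2
    have h3 := ((hK.curve e).lt_iff hm (hf e)).2 (by linarith)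
    subst hx
    refine ⟨hm, (hK.curve e).isChunkConservative_of_bwd (hf e) hc2 hlt, hlt.le,
      by linarith, ?_⟩
    rw [max_eq_right (by linarith), sub_sub_cancel, max_eq_left ha0.le]
    linarith
  · subst hx
    refine ⟨hf e, ⟨fun y hy hyf => ?_, fun hm => ?_⟩, by linarith, by linarith, ?_⟩
    · by_contra hlt
      exact h1 ⟨hfF.2 ⟨y, hy, hyf⟩, (hF y hy hyf).2 (by linarith)⟩
    · by_contra hlt
      exact h2 ⟨hfB hm, (hB hm).2 (by linarith)⟩
    · simp [(mul_pos ha0 hb0).le]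

/-- A bound on the drop of an excess from bounds for the single arcs. -/
lemma realExcess_le_add [Fintype E] {f g : E → ℝ} {μ : V → ℝ} {δ : ℝ}
    (h1 : ∀ e, K.realGain e (f e) ≤ K.realGain e (g e) + δ * μ (K.tgt e))
    (h2 : ∀ e, g e ≤ f e + δ * μ (K.src e)) (i : V) :
    K.realExcess f i ≤ K.realExcess g i + K.degree i * δ * μ i := by
  classical
  have h3 : ∑ e with K.tgt e = i, K.realGain e (f e) ≤
      ∑ e with K.tgt e = i, (K.realGain e (g e) + δ * μ i) :=
    Finset.sum_le_sum fun e he => by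
      rw [← (Finset.mem_filter.1 he).2]; exact h1 e
  have h4 : ∑ e with K.src e = i, g e ≤ ∑ e with K.src e = i, (f e + δ * μ i) :=
    Finset.sum_le_sum fun e he => by
      rw [← (Finset.mem_filter.1 he).2]; exact h2 e
  rw [Finset.sum_add_distrib, Finset.sum_const, nsmul_eq_mul] at h3 h4
  simp only [realExcess, degree]
  push_cast
  linarith

lemma IsPhaseInvariant.adjust [Fintype E] {Δ : ℝ} {f : E → ℝ} {μ : V → ℝ}
    (h : K.IsPhaseInvariant Δ f μ) (hK : K.IsNormalized) :
    K.IsPhaseInvariant (Δ / 2) (K.adjust Δ f μ) μ := by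
  have hp : ∀ i, 0 < Δ / 2 * μ i := fun i => by have := h.scale_mul_pos hK i; linarith
  have hA := fun e => hK.adjust_spec h.mem hp h.conservative e rfl rfl rfl
  refine ⟨half_pos h.scale_pos, fun e => (hA e).1, h.penalty_le, fun e => (hA e).2.1,
    fun i hi => ?_⟩
  have h1 := h.le_excess i hi
  have h2 := realExcess_le_add (fun e => (hA e).2.2.1) (fun e => (hA e).2.2.2.1) i
  linarith

/-- With `f = u` no forward arc is fat, and `Δ = M U + 1` is too large for backward arcs. -/
lemma isPhaseInvariant_init [Fintype V] [Fintype E] (hK : K.IsNormalized) :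
    K.IsPhaseInvariant (K.maxPenalty * K.maxSize + 1) K.upper (fun i => 1 / K.penalty i) := by
  have hM : ∀ i, K.penalty i ≤ K.maxPenalty := fun i =>
    le_ciSup (f := K.penalty) (Set.finite_range _).bddAbove i
  have hM0 : 0 ≤ K.maxPenalty := Real.iSup_nonneg fun i => (hK.penalty_pos i).le
  have hU : ∀ e, K.upper e ≤ K.maxSize := fun e => by
    refine le_max_of_le_right (le_trans ?_ (le_ciSup (f := fun e =>
      max (max |K.lower e| |K.upper e|) (max |(K.gain e (K.upper e)).toReal|
        |(K.gain e (K.lower e)).toReal|)) (Set.finite_range _).bddAbove e))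
    exact le_max_of_le_left (le_max_of_le_right (le_abs_self _))
  have hU0 : 0 ≤ K.maxSize := le_max_of_le_left (Real.iSup_nonneg fun i => abs_nonneg _)
  have hΔ : 0 < K.maxPenalty * K.maxSize + 1 := by positivity
  refine ⟨hΔ, hK.upper_mem, fun i => le_rfl, fun e => ⟨fun y hy hyu => ?_, fun hm => ?_⟩,
    fun i hi => absurd hi (lt_irrefl _)⟩
  · have h1 := mul_pos hΔ (one_div_pos.2 (hK.penalty_pos (K.tgt e)))
    have h2 := ((hK.curve e).lt_iff (hK.upper_mem e) hy).1 (by linarith)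
    exact absurd hy.1.2 (not_le.2 h2)
  · have h1 := hK.nonneg_of_mem hm
    have h2 := hK.penalty_pos (K.src e)
    rw [mul_one_div, sub_nonneg, div_le_iff₀ h2] at h1
    have h3 := mul_le_mul (hU e) (hM (K.src e)) h2.le hU0
    linarith

lemma isPhaseInvariant_of_phaseStart [Fintype V] [Fintype E] (hK : K.IsNormalized) {Δ : ℝ}
    {x : FatPathState V E} (hx : K.PhaseStart Δ x) : K.IsPhaseInvariant Δ x.flow x.label := by
  induction hx with
  | init => exact isPhaseInvariant_init hK
  | next _ hxy ih => exact (ih.phaseLoop hK hxy).adjust hK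

/-! ### Approximate optimality -/

open scoped Classical in
lemma sum_fiber_div [Fintype V] [Fintype E] (p : E → V) (h : E → ℝ) (μ : V → ℝ) :
    ∑ i, (∑ e with p e = i, h e) / μ i = ∑ e, h e / μ (p e) := by
  rw [← Finset.sum_fiberwise Finset.univ p]
  refine Finset.sum_congr rfl fun i _ => ?_
  rw [Finset.sum_div]
  exact Finset.sum_congr rfl fun e he => by rw [(Finset.mem_filter.1 he).2]

lemma sum_degree [Fintype V] [Fintype E] (K : GainNetwork V E) :
    ∑ i, (K.degree i : ℝ) = 2 * Fintype.card E := by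
  classical
  have h1 := sum_fiber_div K.tgt (fun _ => 1) (fun _ => 1)
  have h2 := sum_fiber_div K.src (fun _ => 1) (fun _ => 1)
  simp only [div_one, Finset.sum_const, nsmul_eq_mul, mul_one, Finset.card_univ] at h1 h2
  simp only [degree, Nat.cast_add, Finset.sum_add_distrib, h1, h2]
  ring

/-- The relabeled excesses of two pseudoflows, compared arc by arc. -/
lemma sum_realExcess_sub_div [Fintype V] [Fintype E] (K : GainNetwork V E) (f g : E → ℝ)
    (μ : V → ℝ) : ∑ i, (K.realExcess g i - K.realExcess f i) / μ i =
      ∑ e, ((K.realGain e (g e) - K.realGain e (f e)) / μ (K.tgt e)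
        - (g e - f e) / μ (K.src e)) := by
  classical
  rw [Finset.sum_sub_distrib, ← sum_fiber_div K.tgt, ← sum_fiber_div K.src,
    ← Finset.sum_sub_distrib]
  refine Finset.sum_congr rfl fun i _ => ?_
  rw [← sub_div, Finset.sum_sub_distrib, Finset.sum_sub_distrib]
  simp only [realExcess]
  ring

lemma IsNormalized.discrepancy_eq [Fintype V] [Fintype E] (hK : K.IsNormalized) {f : E → ℝ}
    (hf : ∀ e, f e ∈ K.finiteDom e) :
    K.discrepancy f = ((∑ i, K.penalty i * max (-K.realExcess f i) 0 : ℝ) : EReal) := by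
  simp only [discrepancy, hK.excess_eq hf, coe_sum_ereal, EReal.coe_mul,
    EReal.coe_strictMono.monotone.map_max, EReal.coe_neg, EReal.coe_zero]

/-- Weak duality with the labels as dual variables: conservativity bounds the relabeled excess
that any other pseudoflow can gain, and raised labels occur only at nodes without deficit. -/
lemma IsPhaseInvariant.isApproxOptimal [Fintype V] [Fintype E] {δ C : ℝ} {f : E → ℝ} {μ : V → ℝ}
    (h : K.IsPhaseInvariant δ f μ) (hK : K.IsNormalized)
    (hC : ∑ i, max (K.realExcess f i) 0 / μ i ≤ C) :
    K.IsApproxOptimal (C + Fintype.card E * δ) f := by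
  refine ⟨fun e => (h.mem e).1, ?_⟩
  have hμ := h.label_pos hK
  have hdisc : ∑ i, K.penalty i * max (-K.realExcess f i) 0 ≤
      ∑ i, (max (K.realExcess f i) 0 - K.realExcess f i) / μ i := by
    refine Finset.sum_le_sum fun i _ => ?_
    have hmax : max (K.realExcess f i) 0 - K.realExcess f i = max (-K.realExcess f i) 0 := by
      rcases le_total (K.realExcess f i) 0 with h0 | h0
      · rw [max_eq_right h0, max_eq_left (neg_nonneg.2 h0), zero_sub]
      · rw [max_eq_left h0, max_eq_right (neg_nonpos.2 h0), sub_self]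
    rw [hmax]
    rcases (h.penalty_le i).eq_or_lt with heq | hlt
    · rw [← heq, div_div_eq_mul_div, div_one, mul_comm]
    · have h1 := h.le_excess i hlt
      have h2 : 0 ≤ K.degree i * δ * μ i := by
        rw [mul_assoc]; exact mul_nonneg (Nat.cast_nonneg _) (h.scale_mul_pos hK i).le
      simp [max_eq_right (by linarith : -K.realExcess f i ≤ 0)]
  have hopt : ((∑ i, K.penalty i * max (-K.realExcess f i) 0 - (C + Fintype.card E * δ) : ℝ)
      : EReal) ≤ K.optimum := by
    refine le_sInf ?_
    rintro _ ⟨g, κ, ⟨hg, hκ, hgκ⟩, rfl⟩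
    rw [EReal.coe_le_coe_iff]
    have hgm := mem_finiteDom_of_feasible hg hgκ
    have h1 : ∑ i, (-K.realExcess g i) / μ i ≤ ∑ i, K.penalty i * κ i := by
      refine Finset.sum_le_sum fun i _ => ?_
      have h2 := hgκ i
      rw [hK.excess_eq hgm] at h2
      have h3 : 0 ≤ K.realExcess g i + κ i := by exact_mod_cast h2
      have h4 := h.penalty_le i
      rw [div_le_iff₀ (hK.penalty_pos i)] at h4
      rw [div_le_iff₀ (hμ i)]
      nlinarith [mul_le_mul_of_nonneg_right h4 (hκ i)]
    have h2 : ∑ i, (K.realExcess g i - K.realExcess f i) / μ i ≤ Fintype.card E * δ := by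
      rw [sum_realExcess_sub_div, ← nsmul_eq_mul, ← Finset.card_univ]
      refine Finset.sum_le_card_nsmul _ _ _ fun e _ => ?_
      have h3 := (hK.curve e).sub_mul_le_of_isChunkConservative (h.scale_mul_pos hK _)
        (h.scale_mul_pos hK _) (h.mem e) (h.conservative e) (hgm e)
      have hs := hμ (K.src e)
      have ht := hμ (K.tgt e)
      have h4 : (K.realGain e (g e) - K.realGain e (f e)) * μ (K.src e) ≤
          (g e - f e) * μ (K.tgt e) + δ * (μ (K.src e) * μ (K.tgt e)) :=
        le_of_mul_le_mul_left (by linarith) h.scale_pos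
      rw [div_sub_div _ _ ht.ne' hs.ne', div_le_iff₀ (mul_pos ht hs)]
      linarith
    have h3 : ∑ i, (max (K.realExcess f i) 0 - K.realExcess f i) / μ i =
        ∑ i, max (K.realExcess f i) 0 / μ i +
          ∑ i, (K.realExcess g i - K.realExcess f i) / μ i + ∑ i, (-K.realExcess g i) / μ i := by
      rw [← Finset.sum_add_distrib, ← Finset.sum_add_distrib]
      exact Finset.sum_congr rfl fun i _ => by ring
    linarith
  rw [hK.discrepancy_eq h.mem]
  calc ((∑ i, K.penalty i * max (-K.realExcess f i) 0 : ℝ) : EReal)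
      = ((∑ i, K.penalty i * max (-K.realExcess f i) 0 - (C + Fintype.card E * δ) : ℝ) : EReal)
        + ((C + Fintype.card E * δ : ℝ) : EReal) := by rw [← EReal.coe_add, sub_add_cancel]
    _ ≤ _ := add_le_add_left hopt _

/-- When the set `D` is empty, the relabeled excesses sum up to at most `(n + 2m) Δ`. -/
lemma sum_max_realExcess_le [Fintype V] [Fintype E] (hK : K.IsNormalized) {Δ : ℝ} {f : E → ℝ}
    {μ : V → ℝ} (h : K.IsPhaseInvariant Δ f μ) (hD : K.highNodes f μ Δ = ∅) :
    ∑ i, max (K.realExcess f i) 0 / μ i ≤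
      (Fintype.card V + 2 * Fintype.card E) * Δ := by
  have hi : ∀ i, max (K.realExcess f i) 0 / μ i ≤ (K.degree i + 1) * Δ := fun i => by
    have hp := h.scale_mul_pos hK i
    have hd : (0 : ℝ) ≤ K.degree i := Nat.cast_nonneg _
    have h1 : i ∉ K.highNodes f μ Δ := by rw [hD]; exact Set.notMem_empty i
    simp only [highNodes, Set.mem_ofPred_eq, not_lt, hK.excess_eq h.mem,
      EReal.coe_le_coe_iff] at h1
    rw [div_le_iff₀ (h.label_pos hK i)]
    refine max_le h1 ?_
    rw [mul_assoc]
    positivity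
  calc _ ≤ ∑ i, ((K.degree i : ℝ) + 1) * Δ := Finset.sum_le_sum fun i _ => hi i
    _ = _ := by
      rw [← Finset.sum_mul, Finset.sum_add_distrib, sum_degree, Finset.sum_const, nsmul_eq_mul,
        Finset.card_univ]
      ring

/-- Adjust raises the sum of the relabeled excesses by at most `Δ / 2` for every arc. -/
lemma sum_max_realExcess_adjust_le [Fintype V] [Fintype E] (hK : K.IsNormalized) {Δ : ℝ}
    {f : E → ℝ} {μ : V → ℝ} (h : K.IsPhaseInvariant Δ f μ) :
    ∑ i, max (K.realExcess (K.adjust Δ f μ) i) 0 / μ i ≤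
      ∑ i, max (K.realExcess f i) 0 / μ i + Fintype.card E * (Δ / 2) := by
  classical
  set g := K.adjust Δ f μ with hg
  have hp : ∀ i, 0 < Δ / 2 * μ i := fun i => by have := h.scale_mul_pos hK i; linarith
  have hμ := h.label_pos hK
  have hi : ∀ i, max (K.realExcess g i) 0 ≤ max (K.realExcess f i) 0 +
      (∑ e with K.tgt e = i, max (K.realGain e (g e) - K.realGain e (f e)) 0 +
        ∑ e with K.src e = i, max (f e - g e) 0) := fun i => by
    have h1 : ∑ e with K.tgt e = i, (K.realGain e (g e) - K.realGain e (f e)) ≤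
        ∑ e with K.tgt e = i, max (K.realGain e (g e) - K.realGain e (f e)) 0 :=
      Finset.sum_le_sum fun e _ => le_max_left _ _
    have h2 : ∑ e with K.src e = i, (f e - g e) ≤ ∑ e with K.src e = i, max (f e - g e) 0 :=
      Finset.sum_le_sum fun e _ => le_max_left _ _
    rw [Finset.sum_sub_distrib] at h1 h2
    have h3 := le_max_left (K.realExcess f i) 0
    refine max_le ?_ ?_
    · simp only [realExcess] at h3 ⊢
      linarith
    · have h4 : 0 ≤ ∑ e with K.tgt e = i, max (K.realGain e (g e) - K.realGain e (f e)) 0 :=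
        Finset.sum_nonneg fun e _ => le_max_right _ _
      have h5 : 0 ≤ ∑ e with K.src e = i, max (f e - g e) 0 :=
        Finset.sum_nonneg fun e _ => le_max_right _ _
      have h6 := le_max_right (K.realExcess f i) 0
      linarith
  calc _ ≤ ∑ i, (max (K.realExcess f i) 0 / μ i +
        ((∑ e with K.tgt e = i, max (K.realGain e (g e) - K.realGain e (f e)) 0) / μ i +
        (∑ e with K.src e = i, max (f e - g e) 0) / μ i)) := by
        refine Finset.sum_le_sum fun i _ => ?_
        rw [← add_div, ← add_div]
        exact div_le_div_of_nonneg_right (hi i) (hμ i).le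
    _ = ∑ i, max (K.realExcess f i) 0 / μ i +
        ∑ e, (max (K.realGain e (g e) - K.realGain e (f e)) 0 / μ (K.tgt e) +
          max (f e - g e) 0 / μ (K.src e)) := by
        rw [Finset.sum_add_distrib, Finset.sum_add_distrib, sum_fiber_div, sum_fiber_div,
          Finset.sum_add_distrib]
    _ ≤ _ := by
        rw [← nsmul_eq_mul, ← Finset.card_univ]
        refine add_le_add le_rfl (Finset.sum_le_card_nsmul _ _ _ fun e _ => ?_)
        have h1 := (hK.adjust_spec h.mem hp h.conservative e (x := g e) rfl rfl rfl).2.2.2.2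
        have hs := hμ (K.src e)
        have ht := hμ (K.tgt e)
        have h2 : max (K.realGain e (g e) - K.realGain e (f e)) 0 * μ (K.src e) +
            max (f e - g e) 0 * μ (K.tgt e) ≤ Δ / 2 * (μ (K.src e) * μ (K.tgt e)) :=
          le_of_mul_le_mul_left (by linarith) (half_pos h.scale_pos)
        rw [div_add_div _ _ ht.ne' hs.ne', div_le_iff₀ (mul_pos ht hs)]
        linarith

lemma IsApproxOptimal.mono [Fintype V] [Fintype E] {f : E → ℝ} {ε ε' : ℝ}
    (h : K.IsApproxOptimal ε f) (hε : ε ≤ ε') : K.IsApproxOptimal ε' f :=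
  ⟨h.1, h.2.trans (add_le_add_right (EReal.coe_le_coe_iff.2 hε) _)⟩

/-! ### The normalized instance -/

variable {N : GainNetwork V E}

open scoped Classical in
lemma excess_eq_sum_add [Fintype E] (N : GainNetwork V E) (f : E → ℝ) (i : V) :
    N.excess f i = (∑ e with N.tgt e = i, N.gain e (f e))
      + ((-(∑ e with N.src e = i, f e) - N.demand i : ℝ) : EReal) := by
  rw [excess, sub_eq_add_neg, sub_eq_add_neg, add_assoc, ← EReal.coe_neg, ← EReal.coe_neg,
    ← EReal.coe_add, ← sub_eq_add_neg]

namespace IsConcave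

variable {e : E} {x y : ℝ}

lemma gain_ne_top' (hN : N.IsConcave) (h0 : 0 ≤ x) (h1 : x ≤ N.upper e - N.lower e) :
    N.gain e (x + N.lower e) ≠ ⊤ :=
  hN.gain_ne_top e _ ⟨by linarith, by linarith⟩

/-- Since `(-∞).toReal = 0`, both cases of the definition subtract the same real constant. -/
lemma shiftedGain_eq (hN : N.IsConcave) (e : E) (x : ℝ) : N.shiftedGain e x =
    N.gain e (x + N.lower e) + ((-(N.gain e (N.lower e)).toReal : ℝ) : EReal) := by
  rw [shiftedGain]
  split_ifs with h
  · simp [h]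
  · have h1 := EReal.coe_toReal (hN.gain_ne_top e _ ⟨le_rfl, hN.lower_le_upper e⟩) h
    rw [EReal.coe_neg, ← sub_eq_add_neg, h1]

lemma shiftedGain_mono (hN : N.IsConcave) (h0 : 0 ≤ x) (hxy : x ≤ y)
    (hy : y ≤ N.upper e - N.lower e) : N.shiftedGain e x ≤ N.shiftedGain e y := by
  rw [hN.shiftedGain_eq, hN.shiftedGain_eq]
  exact add_le_add_left (hN.gain_mono e ⟨by linarith, by linarith⟩ ⟨by linarith, by linarith⟩
    (by linarith)) _

lemma shiftedGain_ne_top (hN : N.IsConcave) (h0 : 0 ≤ x) (h1 : x ≤ N.upper e - N.lower e) :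
    N.shiftedGain e x ≠ ⊤ := by
  rw [hN.shiftedGain_eq]
  exact EReal.add_ne_top (hN.gain_ne_top' h0 h1) (EReal.coe_ne_top _)

lemma shiftedGain_max_ne_bot (hN : N.IsConcave) (e : E) :
    N.shiftedGain e (N.upper e - N.lower e) ≠ ⊥ := by
  rw [hN.shiftedGain_eq, sub_add_cancel]
  intro h
  rcases EReal.add_eq_bot_iff.1 h with h | h
  exacts [hN.gain_upper_ne_bot e h, EReal.coe_ne_bot _ h]

lemma shiftedGain_surj (hN : N.IsConcave) {v : EReal} (h0 : 0 ≤ x)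
    (h1 : x ≤ N.upper e - N.lower e) (hx : N.shiftedGain e x ≤ v)
    (hv : v ≤ N.shiftedGain e (N.upper e - N.lower e)) :
    ∃ z, 0 ≤ z ∧ z ≤ N.upper e - N.lower e ∧ N.shiftedGain e z = v := by
  set c := (N.gain e (N.lower e)).toReal with hc
  have hl := hN.shiftedGain_mono (e := e) le_rfl h0 h1
  have hadd : ∀ w : EReal, w + ((-c : ℝ) : EReal) + (c : EReal) = w := fun w => by
    rw [add_assoc, ← EReal.coe_add, neg_add_cancel, EReal.coe_zero, add_zero]
  have hadd' : ∀ w : EReal, w + (c : EReal) + ((-c : ℝ) : EReal) = w := fun w => by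
    rw [add_assoc, ← EReal.coe_add, add_neg_cancel, EReal.coe_zero, add_zero]
  rw [hN.shiftedGain_eq, sub_add_cancel, ← hc] at hv
  have h2 := hl.trans hx
  rw [hN.shiftedGain_eq, zero_add, ← hc] at h2
  obtain ⟨z, hz, hzv⟩ := hN.gain_surjOn e (a := v + (c : EReal))
    ⟨by simpa only [hadd] using add_le_add_left h2 (c : EReal),
      by simpa only [hadd] using add_le_add_left hv (c : EReal)⟩
  refine ⟨z - N.lower e, by linarith [hz.1], by linarith [hz.2], ?_⟩
  rw [hN.shiftedGain_eq, sub_add_cancel, hzv, hadd']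

/-- The upper capacity of the normalized instance attains the maximal gain, by continuity. -/
lemma normalize_upper_spec [Fintype E] (hN : N.IsConcave) (e : E) :
    0 ≤ N.normalize.upper e ∧ N.normalize.upper e ≤ N.upper e - N.lower e ∧
    N.shiftedGain e (N.normalize.upper e) = N.shiftedGain e (N.upper e - N.lower e) := by
  have hlu := sub_nonneg.2 (hN.lower_le_upper e)
  set A := {p : ℝ | 0 ≤ p ∧ p ≤ N.upper e - N.lower e ∧
    N.shiftedGain e p = N.shiftedGain e (N.upper e - N.lower e)} with hA
  have hmem : N.upper e - N.lower e ∈ A := ⟨hlu, le_rfl, rfl⟩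
  have hbdd : BddBelow A := ⟨0, fun p hp => hp.1⟩
  have hp : N.normalize.upper e = sInf A := rfl
  have h0 : 0 ≤ sInf A := le_csInf ⟨_, hmem⟩ fun p hp => hp.1
  have h1 : sInf A ≤ N.upper e - N.lower e := csInf_le hbdd hmem
  rw [hp]
  refine ⟨h0, h1, ?_⟩
  by_contra hne
  have hlt := lt_of_le_of_ne (hN.shiftedGain_mono h0 h1 le_rfl) hne
  -- A point whose gain lies strictly between separates the infimum from the set.
  obtain ⟨v, hv1, hv2⟩ := exists_between hlt
  obtain ⟨q, hq0, hq1, hqv⟩ := hN.shiftedGain_surj h0 h1 hv1.le hv2.le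
  have hq : sInf A < q := by
    by_contra hle
    have := hN.shiftedGain_mono hq0 (not_lt.1 hle) h1
    rw [hqv] at this
    exact absurd hv1 (not_lt.2 this)
  obtain ⟨p, hpA, hpq⟩ := exists_lt_of_csInf_lt ⟨_, hmem⟩ hq
  have := hN.shiftedGain_mono hpA.1 hpq.le hq1
  rw [hpA.2.2, hqv] at this
  exact absurd hv2 (not_lt.2 this)

/-- Where the gain is finite, it is strictly increasing below the smallest maximum point, by
concavity. -/
lemma normalize_isNormalized [Fintype E] (hN : N.IsConcave) : N.normalize.IsNormalized := by
  have hU := hN.normalize_upper_spec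
  have hdom : ∀ e x, x ∈ N.normalize.finiteDom e ↔
      (0 ≤ x ∧ x ≤ N.normalize.upper e) ∧ N.shiftedGain e x ≠ ⊥ := fun e x => Iff.rfl
  have hfin : ∀ e x, x ∈ N.normalize.finiteDom e →
      N.shiftedGain e x = (N.normalize.realGain e x : EReal) := fun e x hx =>
    (EReal.coe_toReal (hN.shiftedGain_ne_top hx.1.1 (hx.1.2.trans (hU e).2.1)) hx.2).symm
  have humem : ∀ e, N.normalize.upper e ∈ N.normalize.finiteDom e := fun e =>
    (hdom e _).2 ⟨⟨(hU e).1, le_rfl⟩, (hU e).2.2 ▸ hN.shiftedGain_max_ne_bot e⟩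
  have hup : ∀ e x y, x ∈ N.normalize.finiteDom e → x ≤ y → y ≤ N.normalize.upper e →
      y ∈ N.normalize.finiteDom e := fun e x y hx hxy hy =>
    ⟨⟨hx.1.1.trans hxy, hy⟩, fun h => hx.2 (le_bot_iff.1
      (h ▸ hN.shiftedGain_mono hx.1.1 hxy (hy.trans (hU e).2.1)))⟩
  have hconc : ∀ e, ConcaveOn ℝ (N.normalize.finiteDom e) (N.normalize.realGain e) := by
    intro e
    have hoc : Set.OrdConnected (N.normalize.finiteDom e) :=
      ⟨fun x hx y hy z hz => hup e x z hx hz.1 (hz.2.trans hy.1.2)⟩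
    refine ⟨hoc.convex, fun x hx y hy a b ha hb hab => ?_⟩
    have hz : a * x + b * y ∈ N.normalize.finiteDom e := hoc.convex hx hy ha hb hab
    have hx1 := hfin e x hx
    have hy1 := hfin e y hy
    have hz1 := hfin e _ hz
    set c := (N.gain e (N.lower e)).toReal with hc
    have key : ∀ (w r : ℝ), N.shiftedGain e w = (r : EReal) →
        N.gain e (w + N.lower e) = ((r + c : ℝ) : EReal) := fun w r h => by
      rw [hN.shiftedGain_eq] at h
      rw [EReal.coe_add, ← h, add_assoc, ← EReal.coe_add, neg_add_cancel, EReal.coe_zero,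
        add_zero]
    have hb' : ∀ w ∈ N.normalize.finiteDom e,
        w + N.lower e ∈ Set.Icc (N.lower e) (N.upper e) := fun w hw => by
      have h1 : 0 ≤ w := hw.1.1
      have h2 : w ≤ _ := hw.1.2.trans (hU e).2.1
      exact ⟨by linarith, by linarith⟩
    have h1 := hN.gain_concave e _ (hb' x hx) _ (hb' y hy) a b ha hb hab
    rw [show a * (x + N.lower e) + b * (y + N.lower e) = (a * x + b * y) + N.lower e by
      linear_combination N.lower e * hab, key _ _ hx1, key _ _ hy1, key _ _ hz1] at h1
    have h2 : a * (N.normalize.realGain e x + c) + b * (N.normalize.realGain e y + c) ≤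
        N.normalize.realGain e (a * x + b * y) + c := by exact_mod_cast h1
    have h3 : (a + b) * c = c := by rw [hab, one_mul]
    simp only [smul_eq_mul]
    linarith
  refine ⟨fun e => rfl, fun e x hx => hN.shiftedGain_ne_top hx.1 (hx.2.trans (hU e).2.1), humem,
    fun e => ⟨hconc e, fun x hx y hy hxy => ?_, fun x hx y hy v hxv hvy => ?_⟩, hN.penalty_pos⟩
  · have hxu := hxy.trans_le hy.1.2
    -- Otherwise `x` would be a smaller maximum point.
    have hlt : N.normalize.realGain e x < N.normalize.realGain e (N.normalize.upper e) := by
      refine lt_of_not_ge fun hge => absurd hxu (not_lt.2 ?_)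
      refine csInf_le ⟨0, fun p hp => hp.1⟩ ⟨hx.1.1, hx.1.2.trans (hU e).2.1, ?_⟩
      refine le_antisymm (hN.shiftedGain_mono hx.1.1 (hx.1.2.trans (hU e).2.1) le_rfl) ?_
      rw [← (hU e).2.2, hfin e x hx, hfin e _ (humem e)]
      exact_mod_cast hge
    rcases (hy.1.2 : y ≤ N.normalize.upper e).eq_or_lt with rfl | hyu
    · exact hlt
    · have h1 := (hconc e).slope_anti_adjacent hx (humem e) hxy hyu
      rw [div_le_div_iff₀ (by linarith) (by linarith)] at h1
      by_contra hge
      push Not at hge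
      have h2 : 0 < (N.normalize.realGain e (N.normalize.upper e) - N.normalize.realGain e y) *
        (y - x) := mul_pos (by linarith) (by linarith)
      have h3 := mul_nonneg (sub_nonneg.2 hge) (sub_nonneg.2 hyu.le)
      linarith
  · have hv1 : N.shiftedGain e x ≤ (v : EReal) := by rw [hfin e x hx]; exact_mod_cast hxv
    have hv2 : (v : EReal) ≤ N.shiftedGain e (N.normalize.upper e) :=
      le_trans (by rw [hfin e y hy]; exact_mod_cast hvy)
        (hN.shiftedGain_mono hy.1.1 hy.1.2 (hU e).2.1)
    obtain ⟨z, hz0, hz1, hzv⟩ := hN.shiftedGain_surj hx.1.1 (hx.1.2.trans (hU e).2.1) hv1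
      ((hU e).2.2 ▸ hv2)
    -- A preimage beyond the new upper capacity can be replaced by that capacity.
    rcases le_total z (N.normalize.upper e) with hzu | hzu
    · exact ⟨z, ⟨⟨hz0, hzu⟩, fun h => EReal.coe_ne_bot v (hzv.symm.trans h)⟩,
        by show (N.shiftedGain e z).toReal = v; rw [hzv, EReal.toReal_coe]⟩
    · refine ⟨_, humem e, ?_⟩
      show (N.shiftedGain e (N.normalize.upper e)).toReal = v
      rw [le_antisymm (hzv ▸ hN.shiftedGain_mono (hU e).1 hzu hz1) hv2, EReal.toReal_coe]

lemma normalize_excess [Fintype E] (hN : N.IsConcave) (f : E → ℝ) (i : V) :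
    N.excess (fun e => N.lower e + f e) i = N.normalize.excess f i := by
  classical
  rw [excess_eq_sum_add, excess_eq_sum_add]
  simp only [normalize, hN.shiftedGain_eq, Finset.sum_add_distrib, ← coe_sum_ereal, add_assoc,
    ← EReal.coe_add, add_comm (N.lower _)]
  congr 2
  rw [Finset.sum_neg_distrib]
  ring

/-- Truncating at the new upper capacities loses no gain and lowers no excess. -/
lemma optimum_normalize_le [Fintype V] [Fintype E] (hN : N.IsConcave) :
    N.normalize.optimum ≤ N.optimum := by
  classical
  refine sInf_le_sInf ?_
  rintro _ ⟨g, κ, ⟨hg, hκ, hgκ⟩, rfl⟩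
  have hU := hN.normalize_upper_spec
  refine ⟨fun e => min (g e - N.lower e) (N.normalize.upper e), κ, ⟨fun e => ?_, hκ, fun i => ?_⟩,
    rfl⟩
  · exact ⟨le_min (sub_nonneg.2 (hg e).1) (hU e).1, min_le_right _ _⟩
  · refine (hgκ i).trans (add_le_add_left ?_ _)
    have h1 := hN.normalize_excess (fun e => g e - N.lower e) i
    simp only [add_sub_cancel] at h1
    rw [h1, excess_eq_sum_add, excess_eq_sum_add]
    refine add_le_add (Finset.sum_le_sum fun e _ => ?_) ?_
    · rcases le_total (g e - N.lower e) (N.normalize.upper e) with h | h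
      · rw [min_eq_left h]
      · rw [min_eq_right h]
        have h3 := hN.shiftedGain_mono (sub_nonneg.2 (hg e).1)
          (sub_le_sub_right (hg e).2 (N.lower e)) le_rfl
        exact h3.trans (hU e).2.2.ge
    · refine EReal.coe_le_coe_iff.2 (sub_le_sub_right (neg_le_neg ?_) _)
      exact Finset.sum_le_sum fun e _ => min_le_left _ _

lemma isApproxOptimal_of_normalize [Fintype V] [Fintype E] (hN : N.IsConcave) {ε : ℝ}
    {f : E → ℝ} (h : N.normalize.IsApproxOptimal ε f) :
    N.IsApproxOptimal ε (fun e => N.lower e + f e) := by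
  refine ⟨fun e => ?_, ?_⟩
  · have h1 : 0 ≤ f e := (h.1 e).1
    have h2 := (h.1 e).2.trans (hN.normalize_upper_spec e).2.1
    exact ⟨by linarith, by linarith⟩
  · refine le_trans (le_of_eq ?_) (h.2.trans (add_le_add_left hN.optimum_normalize_le _))
    simp only [discrepancy, hN.normalize_excess]
    rfl

end IsConcave

end GainNetwork

theorem mainTheorem3 {V E : Type*} [Fintype V] [Fintype E] (N : GainNetwork V E)
    (hN : N.IsConcave) (Δ : ℝ) (x y : FatPathState V E)
    (hx : N.normalize.PhaseStart Δ x) (hxy : N.normalize.PhaseLoop Δ x y)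
    (f : E → ℝ) (hf : f = y.flow ∨ f = N.normalize.adjust Δ y.flow y.label) :
    N.normalize.IsApproxOptimal ((2 * Fintype.card V + 3 * Fintype.card E) * Δ) f ∧
    N.IsApproxOptimal ((2 * Fintype.card V + 3 * Fintype.card E) * Δ)
      (fun e => N.lower e + f e) := by
  have hK := hN.normalize_isNormalized
  have hy := (GainNetwork.isPhaseInvariant_of_phaseStart hK hx).phaseLoop hK hxy
  obtain ⟨-, -, -, hD⟩ := hxy
  have hsum := GainNetwork.sum_max_realExcess_le hK hy hD
  have hn : 0 ≤ (Fintype.card V : ℝ) * Δ := mul_nonneg (Nat.cast_nonneg _) hy.scale_pos.le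
  have key : N.normalize.IsApproxOptimal ((2 * Fintype.card V + 3 * Fintype.card E) * Δ) f := by
    rcases hf with rfl | rfl
    · exact (hy.isApproxOptimal hK hsum).mono (by linarith)
    · exact ((hy.adjust hK).isApproxOptimal hK ((GainNetwork.sum_max_realExcess_adjust_le hK
        hy).trans (add_le_add_left hsum _))).mono (by linarith)
  exact ⟨key, hN.isApproxOptimal_of_normalize key⟩
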